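/- **Setting.** Let $A\subset\mathbb R^m$ be nonempty and compact, let $f:\mathbb R^d\times A\to\mathbb R^d$ and $g:\mathbb R^d\times A\to\mathbb R$ be continuous and bounded, and Lipschitz in the first variable uniformly in $a\in A$, with constants $L_f$ and $L_g$ respectively, and let $\lambda>L_f$. Let $$v(x)=\inf_{\alpha}\int_0^\infty g(y(s),\alpha(s))e^{-\lambda s}\,ds ,$$ where the infimum is over all measurable $\alpha:[0,\infty)\to A$ and $y$ is the solution of $\dot y=f(y,\alpha)$, $y(0)=x$. Let $\Omega=\prod_{k=1}^d[l_k,u_k]$ with $l_k<u_k$ for all $k$. A *grid* on $\Omega$ is a regular equidistant array of nodes $(x_i)$ of spacing $\Delta x$ that subdivides $\Omega$ exactly into cubes. For nodal values $V$, $I[V]$ is their multilinear interpolant on $\Omega$. For $\Delta t>0$ put $\gamma=e^{-\lambda\Delta t}\in(0,1)$. A *discretization* is a grid together with $\Delta t>0$; it is *invariant* if $x_i+\Delta t f(x_i,a)\in\Omega$ for all nodes $x_i$ and all $a\in A$. Its Bellman operator is $$T(V)_i=\min_{a\in A}\{\gamma I[V](x_i+\Delta t f(x_i,a))+\Delta t\,g(x_i,a)\},$$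 and its *discrete solution* is the fixed point $V=T(V)$. *Value iteration* is $V^{n+1}=T(V^n)$ with arbitrary $V^0$. *Policy iteration* from $W^0$ is: choose for each node $a_i^{n}\in\arg\min_{a\in A}\{\gamma I[W^n](x_i+\Delta t f(x_i,a))+\Delta t\, g(x_i,a)\}$, then let $W^{n+1}$ solve $W^{n+1}_i=\gamma I[W^{n+1}](x_i+\Delta t f(x_i,a_i^n))+\Delta t\,g(x_i,a_i^n)$ for all $i$. All norms of grid functions are maximum norms. Take two discretizations of $\Omega$, a coarse one $(\Delta x_c,\Delta t_c)$ and a fine one $(\Delta x,\Delta t)$ (the two may coincide, and no relation between them is required). Let $V^N$ be the $N$-th value iterate on the coarse one, $V$ the discrete solution of the fine one, and $W^0=W^{0,N}$ the grid function on the fine grid obtained from $V^N$ by multilinear interpolation. **1)** For every $\rho>0$ there are $\tau,\eta>0$ such that, whenever both discretizations are invariant, $\Delta t_c,\Delta t\le\tau$, $\Delta x_c\le\eta\,\Delta t_c$ and $\Delta x\le\eta\,\Delta t$, then for every $V^0$ there is $N_0$ such that for all $N\ge N_0$ $$\max_i|v(x_i)-V^N_i|<\rho\ \text{ (maximum over the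 coarse nodes)},\qquad \|W^{0,N}-V\|<\rho .$$ Moreover, on each single invariant discretization, with discrete solution $V$, value iteration satisfies $\|V^N-V\|\le\gamma^N\|V^0-V\|$ for all $N$ and all $V^0$. **2)** Let the fine discretization be invariant, let $N\ge0$ and $V^0$ be arbitrary and $W^0=W^{0,N}$. Put $F(U)=U-T(U)$ with $T$ the Bellman operator of the fine discretization. Assume the following conditions for Newton's method for $F$ from $W^0$: there are an open convex set $D\ni W^0$ and constants $\alpha$ and $\bar\omega>0$ such that $F$ is continuously Fréchet differentiable on $D$, $F'(W^0)$ is invertible, $\|F'(W^0)^{-1}F(W^0)\|\le\alpha$, $\|F'(W^0)^{-1}(F'(Y)-F'(X))\|\le\bar\omega\|Y-X\|$ for $X,Y\in D$, $h_0:=\alpha\bar\omega\le\frac12$, and the open ball with centre $W^0$ and radius $(1-\sqrt{1-2h_0})/\bar\omega$ is contained in $D$. Let $$\mu=\frac{C\gamma}{\Delta x^2(1-\gamma)},$$ where $C$ is any constant with $2\gamma C\ge(1+\gamma)\,\bar\omega\,\Delta x^2$ (the same $C$ may thus serve for all fine discretizations for which $\bar\omega\Delta x^2(1+\gamma)/(2\gamma)$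 stays bounded by $C$). Then policy iteration from $W^0$ is well defined, and every sequence $(W^n)$ generated by it converges to $V$, quadratically: $$\|W^{n+1}-V\|\le\mu\,\|W^n-V\|^2\qquad(n\ge0).$$ If moreover $\|W^0-V\|\le\rho$ with $\rho<1$ and $\mu\rho<1$, then for every $M\ge1$ the iterate $V_{API}=W^M$ satisfies $$\|V_{API}-V\|\le\mu\prod_{k=1}^M\left(\mu^{2(k-1)}\rho^2\right).$$ -/

import Mathlib

open scoped NNReal

/-- The data of an infinite horizon optimal control problem in `ℝ^d` with controls in `ℝ^m`:
control set `A`, dynamics `f`, running cost `g`, discount rate `lam`. -/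
structure ControlProblem (d m : ℕ) where
  A : Set (EuclideanSpace ℝ (Fin m))
  f : EuclideanSpace ℝ (Fin d) → EuclideanSpace ℝ (Fin m) → EuclideanSpace ℝ (Fin d)
  g : EuclideanSpace ℝ (Fin d) → EuclideanSpace ℝ (Fin m) → ℝ
  lam : ℝ

/-- The computational domain `Ω`: the closed box with opposite corners `l` and `u`. -/
def box {d : ℕ} (l u : Fin d → ℝ) : Set (EuclideanSpace ℝ (Fin d)) :=
  {x | ∀ k, l k ≤ x k ∧ x k ≤ u k}

/-- A regular equidistant grid on the box: mesh spacing `dx` in every direction and `n k` cells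
along the `k`-th axis. -/
structure Grid {d : ℕ} (l u : Fin d → ℝ) where
  dx : ℝ
  dx_pos : 0 < dx
  n : Fin d → ℕ
  fits : ∀ k, l k + n k * dx = u k

namespace Grid

variable {d : ℕ} {l u : Fin d → ℝ}

/-- Multi-indices of the grid nodes. -/
abbrev Node (G : Grid l u) : Type := (k : Fin d) → Fin (G.n k + 1)

/-- The grid node with multi-index `i`. -/
noncomputable def point (G : Grid l u) (i : G.Node) : EuclideanSpace ℝ (Fin d) :=
  WithLp.toLp 2 fun k => l k + ((i k : ℕ) : ℝ) * G.dx

/-- Multilinear interpolation of nodal values, written in the basis of tensor products of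
one-dimensional hat functions; on each cell of the box this is the multilinear interpolant of the
values at the vertices of the cell. -/
noncomputable def interp (G : Grid l u) (V : G.Node → ℝ) (x : EuclideanSpace ℝ (Fin d)) : ℝ :=
  ∑ i : G.Node, V i * ∏ k : Fin d, max 0 (1 - |x k - G.point i k| / G.dx)

/-- Transfer of a grid function from the grid `G` to the grid `G'` by multilinear interpolation. -/
noncomputable def transfer (G G' : Grid l u) (V : G.Node → ℝ) : G'.Node → ℝ :=
  fun i => G.interp V (G'.point i)

end Grid

namespace ControlProblem

variable {d m : ℕ} {l u : Fin d → ℝ}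

/-- Admissible (open-loop) controls: measurable, with values in `A`. -/
def IsAdmissible (P : ControlProblem d m) (α : ℝ → EuclideanSpace ℝ (Fin m)) : Prop :=
  Measurable α ∧ ∀ t, 0 ≤ t → α t ∈ P.A

/-- `y` is the (Caratheodory) solution on `[0, ∞)` of `y' = f (y, α)`, `y 0 = x`. -/
def IsTrajectory (P : ControlProblem d m) (x : EuclideanSpace ℝ (Fin d))
    (α : ℝ → EuclideanSpace ℝ (Fin m)) (y : ℝ → EuclideanSpace ℝ (Fin d)) : Prop :=
  ContinuousOn y (Set.Ici 0) ∧ ∀ t, 0 ≤ t → y t = x + ∫ s in (0 : ℝ)..t, P.f (y s) (α s)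

/-- The discounted cost of a control along its trajectory. -/
noncomputable def cost (P : ControlProblem d m) (α : ℝ → EuclideanSpace ℝ (Fin m))
    (y : ℝ → EuclideanSpace ℝ (Fin d)) : ℝ :=
  ∫ s in Set.Ioi (0 : ℝ), P.g (y s) (α s) * Real.exp (-P.lam * s)

/-- The value function `v` of the continuous problem. -/
noncomputable def value (P : ControlProblem d m) (x : EuclideanSpace ℝ (Fin d)) : ℝ :=
  sInf {J | ∃ α y, P.IsAdmissible α ∧ P.IsTrajectory x α y ∧ J = P.cost α y}

/-- The discount factor `γ = e^{-λ Δt}`. -/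
noncomputable def discount (P : ControlProblem d m) (dt : ℝ) : ℝ := Real.exp (-P.lam * dt)

/-- The quantity minimized at the node `x_i` in the discrete Bellman equation:
`γ I[V](x_i + Δt f(x_i, a)) + Δt g(x_i, a)`. -/
noncomputable def stepCost (P : ControlProblem d m) (G : Grid l u) (dt : ℝ) (V : G.Node → ℝ)
    (i : G.Node) (a : EuclideanSpace ℝ (Fin m)) : ℝ :=
  P.discount dt * G.interp V (G.point i + dt • P.f (G.point i) a) + dt * P.g (G.point i) a

/-- The discrete Bellman operator `T`. For compact nonempty `A` and data continuous in the control,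
the infimum is a minimum. -/
noncomputable def bellman (P : ControlProblem d m) (G : Grid l u) (dt : ℝ) (V : G.Node → ℝ) :
    G.Node → ℝ :=
  fun i => sInf (P.stepCost G dt V i '' P.A)

/-- The invariance condition: no discrete step starting at a node leaves the box. -/
def Invariant (P : ControlProblem d m) (G : Grid l u) (dt : ℝ) : Prop :=
  ∀ i : G.Node, ∀ a ∈ P.A, G.point i + dt • P.f (G.point i) a ∈ box l u

/-- The `N`-th iterate of value iteration started at `V0`. -/
noncomputable def valueIter (P : ControlProblem d m) (G : Grid l u) (dt : ℝ) (V0 : G.Node → ℝ)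
    (N : ℕ) : G.Node → ℝ :=
  (P.bellman G dt)^[N] V0

/-- `W` is a sequence generated by policy iteration: `a n` is a greedy policy for `W n` (policy
improvement), and `W (n + 1)` solves the linear equation of this policy (policy evaluation). -/
def IsPolicyIteration (P : ControlProblem d m) (G : Grid l u) (dt : ℝ)
    (W : ℕ → G.Node → ℝ) : Prop :=
  ∃ a : ℕ → G.Node → EuclideanSpace ℝ (Fin m), ∀ n i,
    a n i ∈ P.A ∧ IsMinOn (P.stepCost G dt (W n) i) P.A (a n i) ∧
      W (n + 1) i = P.stepCost G dt (W (n + 1)) i (a n i)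

end ControlProblem

/-- The classical affine covariant assumptions on a map `F` for the convergence of Newton's method
from the starting point `x₀`, on an open convex set `D`, with constants `α` and `ω`. -/
structure NewtonAssumptions {X Y : Type*} [NormedAddCommGroup X] [NormedSpace ℝ X]
    [NormedAddCommGroup Y] [NormedSpace ℝ Y] (F : X → Y) (D : Set X) (x₀ : X) (α ω : ℝ) :
    Prop where
  isOpen : IsOpen D
  convex : Convex ℝ D
  contDiffOn : ContDiffOn ℝ 1 F D
  mem : x₀ ∈ D
  invertible : (fderiv ℝ F x₀).IsInvertible
  norm_step_le : ‖(fderiv ℝ F x₀).inverse (F x₀)‖ ≤ α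
  omega_pos : 0 < ω
  lipschitz : ∀ x ∈ D, ∀ y ∈ D,
    ‖(fderiv ℝ F x₀).inverse.comp (fderiv ℝ F y - fderiv ℝ F x)‖ ≤ ω * ‖y - x‖
  kantorovich : α * ω ≤ 1 / 2
  ball_subset : Metric.ball x₀ ((1 - √(1 - 2 * (α * ω))) / ω) ⊆ D

/-! The first half is a doubling-of-variables error estimate for a monotone scheme. The value
function `v` is Lipschitz because `λ > L_f`, and dynamic programming makes it a sub- and
supersolution of the Hamilton-Jacobi-Bellman equation against quadratic test functions. One
maximizes `±(V i - v y) - κ ‖x i - y‖²` over nodes `i` and all `y`. No regularity of `V` is needed: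
maximality bounds `±V` at the nodes by a quadratic, and the interpolation weights at `x` form a
probability distribution with mean `x` and variance at most `d Δx²`, so interpolation preserves that
bound up to `κ d Δx²`. Dividing the one-step inequality by `Δt` gives `|v - V| ≤ C (κ Δt + 1/κ)`
when `Δx ≤ Δt` (`exists_abs_value_sub_fixedPt_le`). The γ-contraction of `T` and the interpolation
error of `v` do the rest.

The second half identifies policy iteration with Newton's method. The affine map of a greedy policy
at `U` lies above `T` and touches it at `U`, so where `F = id - T` is differentiable its derivative
is `id` minus the linear part of the policy (`fderiv_residual`). A scalar majorant keeps the
iterates in `D` (`newton_mem`). Separately, monotonicity shows that policy iteration converges to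
`V` from any start, so `V` lies in the closure of `D` and the affine covariant remainder bound
extends to it. Since `‖F'(W⁰)‖ ≤ 1 + γ` and `F'(Wⁿ)` is bounded below by `1 - γ`, the error is
squared with factor `(1 + γ) ω / (2 (1 - γ)) ≤ μ` (`policyIteration_quadratic`). The product bound
is a weakening of `μ^(2^M - 1) ρ^(2^M)`. -/

/-! ### Hat functions, interpolation weights and their moments -/

/-- Only the first regime is wanted, but its induction step on `[n, n + 1]` needs the decreasing
tail of the last hat, which in turn needs the vanishing beyond it. -/
theorem sum_hat_cases (n : ℕ) {s : ℝ} (hs : 0 ≤ s) :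
    (s ≤ n → ∑ j ∈ Finset.range (n + 1), max 0 (1 - |s - j|) = 1 ∧
      ∑ j ∈ Finset.range (n + 1), max 0 (1 - |s - j|) * j = s) ∧
    (n ≤ s → s ≤ n + 1 → ∑ j ∈ Finset.range (n + 1), max 0 (1 - |s - j|) = n + 1 - s ∧
      ∑ j ∈ Finset.range (n + 1), max 0 (1 - |s - j|) * j = n * (n + 1 - s)) ∧
    ((n : ℝ) + 1 ≤ s → ∑ j ∈ Finset.range (n + 1), max 0 (1 - |s - j|) = 0 ∧
      ∑ j ∈ Finset.range (n + 1), max 0 (1 - |s - j|) * j = 0) := by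
  induction n with
  | zero =>
    simp only [zero_add, Finset.range_one, Finset.sum_singleton, Nat.cast_zero, sub_zero,
      mul_zero, zero_mul, abs_of_nonneg hs]
    refine ⟨fun h => ?_, fun _ h => ?_, fun h => ?_⟩
    · have : s = 0 := le_antisymm h hs
      simp [this]
    · simp [h]
    · simp [h]
  | succ n ih =>
    obtain ⟨h1, h2, h3⟩ := ih
    simp only [Finset.sum_range_succ _ (n + 1)]
    push_cast at *
    refine ⟨fun h => ?_, fun h h' => ?_, fun h => ?_⟩
    · rcases le_total s n with hn | hn
      · obtain ⟨e1, e2⟩ := h1 hn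
        have : max 0 (1 - |s - (n + 1)|) = 0 := by
          rw [abs_of_nonpos (by linarith)]; exact max_eq_left (by linarith)
        rw [e1, e2, this]; constructor <;> ring
      · obtain ⟨e1, e2⟩ := h2 hn h
        have : max 0 (1 - |s - (n + 1)|) = s - n := by
          rw [abs_of_nonpos (by linarith), max_eq_right (by linarith)]; ring
        rw [e1, e2, this]; constructor <;> ring
    · obtain ⟨e1, e2⟩ := h3 h
      have : max 0 (1 - |s - (n + 1)|) = n + 1 + 1 - s := by
        rw [abs_of_nonneg (by linarith), max_eq_right (by linarith)]; ring
      rw [e1, e2, this]; constructor <;> ring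
    · obtain ⟨e1, e2⟩ := h3 (by linarith)
      have : max 0 (1 - |s - (n + 1)|) = 0 := by
        rw [abs_of_nonneg (by linarith)]; exact max_eq_left (by linarith)
      rw [e1, e2, this]; constructor <;> ring

namespace Grid

variable {d : ℕ} {l u : Fin d → ℝ}

/-- The one-dimensional hat function of the `j`-th node along the `k`-th axis. -/
noncomputable def hat (G : Grid l u) (k : Fin d) (t : ℝ) (j : Fin (G.n k + 1)) : ℝ :=
  max 0 (1 - |t - (l k + (j : ℕ) * G.dx)| / G.dx)

/-- The multilinear interpolation weight of the node `i` at `x`. -/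
noncomputable def weight (G : Grid l u) (x : EuclideanSpace ℝ (Fin d)) (i : G.Node) : ℝ :=
  ∏ k, G.hat k (x k) (i k)

theorem interp_eq (G : Grid l u) (V : G.Node → ℝ) (x : EuclideanSpace ℝ (Fin d)) :
    G.interp V x = ∑ i, V i * G.weight x i := rfl

theorem point_apply (G : Grid l u) (i : G.Node) (k : Fin d) :
    G.point i k = l k + (i k : ℕ) * G.dx := rfl

theorem hat_eq (G : Grid l u) (k : Fin d) (t : ℝ) (j : Fin (G.n k + 1)) :
    G.hat k t j = max 0 (1 - |(t - l k) / G.dx - (j : ℕ)|) := by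
  have h := G.dx_pos
  rw [hat, show (t - l k) / G.dx - (j : ℕ) = (t - (l k + (j : ℕ) * G.dx)) / G.dx by
    field_simp; ring, abs_div, abs_of_pos h]

theorem hat_nonneg (G : Grid l u) (k : Fin d) (t : ℝ) (j : Fin (G.n k + 1)) :
    0 ≤ G.hat k t j := le_max_left _ _

theorem sum_hat (G : Grid l u) (k : Fin d) {t : ℝ} (h : l k ≤ t ∧ t ≤ u k) :
    ∑ j, G.hat k t j = 1 ∧ ∑ j, G.hat k t j * (l k + (j : ℕ) * G.dx) = t := by
  have hdx := G.dx_pos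
  have h0 : 0 ≤ (t - l k) / G.dx := div_nonneg (by linarith [h.1]) hdx.le
  have h1 : (t - l k) / G.dx ≤ G.n k := by
    rw [div_le_iff₀ hdx]; linarith [G.fits k, h.2]
  obtain ⟨e1, e2⟩ := (sum_hat_cases (G.n k) h0).1 h1
  rw [← Fin.sum_univ_eq_sum_range (fun j : ℕ => max 0 (1 - |(t - l k) / G.dx - j|))] at e1
  rw [← Fin.sum_univ_eq_sum_range
    (fun j : ℕ => max 0 (1 - |(t - l k) / G.dx - j|) * (j : ℝ))] at e2
  simp only [hat_eq, mul_add, Finset.sum_add_distrib]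
  refine ⟨e1, ?_⟩
  rw [← Finset.sum_mul, e1]
  simp only [← mul_assoc]
  rw [← Finset.sum_mul, e2]
  field_simp
  ring

theorem weight_nonneg (G : Grid l u) (x : EuclideanSpace ℝ (Fin d)) (i : G.Node) :
    0 ≤ G.weight x i := Finset.prod_nonneg fun _ _ => G.hat_nonneg _ _ _

/-- The marginal of a product distribution: the factors along the other axes sum to one. It reduces
moments of the weights to one dimension. -/
theorem sum_weight_mul (G : Grid l u) {x : EuclideanSpace ℝ (Fin d)} (hx : x ∈ box l u)
    (k : Fin d) (h : Fin (G.n k + 1) → ℝ) :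
    ∑ i, G.weight x i * h (i k) = ∑ j, G.hat k (x k) j * h j := by
  classical
  -- Absorbing `h` into the factor of axis `k` makes the sum over multi-indices a product of
  -- one-dimensional sums; the cast is needed because the index type depends on the axis.
  have key : ∀ i : G.Node, G.weight x i * h (i k) =
      ∏ k', (G.hat k' (x k') (i k') * if e : k' = k then h (e ▸ i k') else 1) := by
    intro i
    rw [Finset.prod_mul_distrib]
    congr 1
    rw [Finset.prod_eq_single k]
    · simp
    · intro b _ hb; simp [hb]
    · simp
  simp only [key]
  rw [← Fintype.prod_sum
    (fun k' (j : Fin (G.n k' + 1)) => G.hat k' (x k') j * if e : k' = k then h (e ▸ j) else 1),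
    Finset.prod_eq_single k]
  · simp
  · intro b _ hb; simp [hb, (G.sum_hat b (hx b)).1]
  · simp

theorem sum_weight (G : Grid l u) {x : EuclideanSpace ℝ (Fin d)} (hx : x ∈ box l u) :
    ∑ i, G.weight x i = 1 := by
  unfold weight
  rw [← Fintype.prod_sum (fun k j => G.hat k (x k) j)]
  exact Finset.prod_eq_one fun k _ => (G.sum_hat k (hx k)).1

/-- A hat function vanishes at distance more than `dx` from its node. -/
theorem hat_mul_sq_le (G : Grid l u) (k : Fin d) (t : ℝ) (j : Fin (G.n k + 1)) :
    G.hat k t j * (l k + (j : ℕ) * G.dx - t) ^ 2 ≤ G.hat k t j * G.dx ^ 2 := by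
  have hdx := G.dx_pos
  by_cases h : |t - (l k + (j : ℕ) * G.dx)| ≤ G.dx
  · apply mul_le_mul_of_nonneg_left _ (G.hat_nonneg _ _ _)
    rw [abs_sub_comm] at h
    exact sq_le_sq' (abs_le.1 h).1 (abs_le.1 h).2
  · have : G.hat k t j = 0 := by
      apply max_eq_left
      have : 1 ≤ |t - (l k + (j : ℕ) * G.dx)| / G.dx := by
        rw [le_div_iff₀ hdx]; linarith
      linarith
    simp [this]

/-- Bias-variance decomposition: the weights have mean `x`, so the cross term drops out, and each
axis contributes variance at most `dx ^ 2`. -/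
theorem sum_weight_mul_norm_sq_le (G : Grid l u) {x : EuclideanSpace ℝ (Fin d)}
    (hx : x ∈ box l u) (y : EuclideanSpace ℝ (Fin d)) :
    ∑ i, G.weight x i * ‖G.point i - y‖ ^ 2 ≤ ‖x - y‖ ^ 2 + d * G.dx ^ 2 := by
  simp only [EuclideanSpace.real_norm_sq_eq, Finset.mul_sum, PiLp.sub_apply, point_apply]
  rw [Finset.sum_comm]
  have : (d : ℝ) * G.dx ^ 2 = ∑ k : Fin d, G.dx ^ 2 := by simp
  rw [this, ← Finset.sum_add_distrib]
  refine Finset.sum_le_sum fun k _ => ?_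
  rw [G.sum_weight_mul hx k (fun j => (l k + (j : ℕ) * G.dx - y k) ^ 2)]
  obtain ⟨e1, e2⟩ := G.sum_hat k (hx k)
  have e3 := Finset.sum_le_sum fun j (_ : j ∈ Finset.univ) => G.hat_mul_sq_le k (x k) j
  rw [← Finset.sum_mul, e1] at e3
  have : ∀ j, G.hat k (x k) j * (l k + (j : ℕ) * G.dx - y k) ^ 2 =
      G.hat k (x k) j * (l k + (j : ℕ) * G.dx - x k) ^ 2 +
        (G.hat k (x k) j * (l k + (j : ℕ) * G.dx) * (2 * (x k - y k)) +
          G.hat k (x k) j * ((x k - y k) ^ 2 - 2 * (x k - y k) * x k)) := fun j => by ring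
  simp only [this, Finset.sum_add_distrib]
  rw [← Finset.sum_mul, ← Finset.sum_mul, e1, e2]
  linarith

theorem point_mem_box (G : Grid l u) (i : G.Node) : G.point i ∈ box l u := by
  intro k
  have h := G.dx_pos
  have h1 : ((i k : ℕ) : ℝ) ≤ G.n k := by exact_mod_cast Nat.lt_succ_iff.1 (i k).2
  rw [point_apply, ← G.fits k]
  constructor
  · have : 0 ≤ ((i k : ℕ) : ℝ) * G.dx := by positivity
    linarith
  · have := mul_le_mul_of_nonneg_right h1 h.le
    linarith

theorem interp_sub (G : Grid l u) (U V : G.Node → ℝ) (x : EuclideanSpace ℝ (Fin d)) :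
    G.interp (U - V) x = G.interp U x - G.interp V x := by
  simp only [interp_eq, Pi.sub_apply, sub_mul, Finset.sum_sub_distrib]

theorem interp_le (G : Grid l u) {V : G.Node → ℝ} {x : EuclideanSpace ℝ (Fin d)}
    (hx : x ∈ box l u) {c : ℝ} (h : ∀ i, V i ≤ c) : G.interp V x ≤ c := by
  calc G.interp V x ≤ ∑ i, c * G.weight x i :=
        Finset.sum_le_sum fun i _ => mul_le_mul_of_nonneg_right (h i) (G.weight_nonneg x i)
    _ = c := by rw [← Finset.mul_sum, G.sum_weight hx, mul_one]

theorem interp_mono (G : Grid l u) {U V : G.Node → ℝ} (h : ∀ i, U i ≤ V i)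
    (x : EuclideanSpace ℝ (Fin d)) : G.interp U x ≤ G.interp V x :=
  Finset.sum_le_sum fun i _ => mul_le_mul_of_nonneg_right (h i) (G.weight_nonneg x i)

theorem interp_neg (G : Grid l u) (V : G.Node → ℝ) (x : EuclideanSpace ℝ (Fin d)) :
    G.interp (fun i => -V i) x = -G.interp V x := by
  simp only [interp_eq, neg_mul, Finset.sum_neg_distrib]

theorem abs_interp_le (G : Grid l u) {V : G.Node → ℝ} {x : EuclideanSpace ℝ (Fin d)}
    (hx : x ∈ box l u) {c : ℝ} (h : ∀ i, |V i| ≤ c) : |G.interp V x| ≤ c := by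
  refine abs_le.2 ⟨?_, G.interp_le hx fun i => (abs_le.1 (h i)).2⟩
  have := G.interp_le (V := fun i => -V i) hx fun i => neg_le.1 (abs_le.1 (h i)).1
  rw [interp_neg] at this
  linarith

theorem continuous_interp (G : Grid l u) (V : G.Node → ℝ) : Continuous (G.interp V) := by
  unfold interp
  fun_prop

/-- Interpolation error for Lipschitz functions. -/
theorem abs_interp_sub_le (G : Grid l u) {φ : EuclideanSpace ℝ (Fin d) → ℝ} {K : ℝ≥0}
    (hφ : LipschitzWith K φ) {x : EuclideanSpace ℝ (Fin d)} (hx : x ∈ box l u) :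
    |G.interp (fun i => φ (G.point i)) x - φ x| ≤ K * (d + 1) * G.dx := by
  have hdx := G.dx_pos
  have e : G.interp (fun i => φ (G.point i)) x - φ x =
      ∑ i, (φ (G.point i) - φ x) * G.weight x i := by
    simp only [sub_mul, Finset.sum_sub_distrib]
    rw [← Finset.mul_sum, G.sum_weight hx, mul_one, interp_eq]
  have h2 := G.sum_weight_mul_norm_sq_le hx x
  simp only [sub_self, norm_zero] at h2
  have hK : (0 : ℝ) ≤ K := K.2
  calc |G.interp (fun i => φ (G.point i)) x - φ x|
      ≤ ∑ i, |(φ (G.point i) - φ x) * G.weight x i| := by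
        rw [e]; exact Finset.abs_sum_le_sum_abs _ _
    _ ≤ ∑ i, (K * (G.dx⁻¹ * (G.weight x i * ‖G.point i - x‖ ^ 2)) +
          K * (G.dx * G.weight x i)) := by
        refine Finset.sum_le_sum fun i _ => ?_
        rw [abs_mul, abs_of_nonneg (G.weight_nonneg x i)]
        have h1 := hφ.dist_le_mul (G.point i) x
        rw [Real.dist_eq, dist_eq_norm] at h1
        -- Bounding the distance by its square lets the second moment control the first.
        have h3 : ‖G.point i - x‖ ≤ G.dx⁻¹ * ‖G.point i - x‖ ^ 2 + G.dx := by
          have : 0 ≤ G.dx⁻¹ * (‖G.point i - x‖ - G.dx) ^ 2 := by positivity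
          have h4 : G.dx⁻¹ * (‖G.point i - x‖ - G.dx) ^ 2 =
              G.dx⁻¹ * ‖G.point i - x‖ ^ 2 - 2 * ‖G.point i - x‖ + G.dx := by
            field_simp; ring
          nlinarith [norm_nonneg (G.point i - x)]
        calc _ ≤ (K * (G.dx⁻¹ * ‖G.point i - x‖ ^ 2 + G.dx)) * G.weight x i :=
              mul_le_mul_of_nonneg_right (h1.trans (mul_le_mul_of_nonneg_left h3 hK))
                (G.weight_nonneg x i)
          _ = _ := by ring
    _ = K * (G.dx⁻¹ * ∑ i, G.weight x i * ‖G.point i - x‖ ^ 2) + K * (G.dx * 1) := by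
        rw [Finset.sum_add_distrib, ← G.sum_weight hx]
        simp only [Finset.mul_sum]
    _ ≤ K * (G.dx⁻¹ * (d * G.dx ^ 2)) + K * (G.dx * 1) := by
        gcongr
        linarith
    _ = K * (d + 1) * G.dx := by field_simp

end Grid

/-- The standing assumptions on a control problem: compact control set, continuous bounded data,
Lipschitz in the state uniformly in the control, and discount rate above the Lipschitz constant of
the dynamics. -/
structure ControlProblem.IsRegular {d m : ℕ} (P : ControlProblem d m) (Lf Lg : ℝ≥0) (Mf Mg : ℝ) :
    Prop where
  isCompact : IsCompact P.A
  nonempty : P.A.Nonempty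
  continuousOn_f : ContinuousOn (fun p : EuclideanSpace ℝ (Fin d) × EuclideanSpace ℝ (Fin m) =>
      P.f p.1 p.2) (Set.univ ×ˢ P.A)
  continuousOn_g : ContinuousOn (fun p : EuclideanSpace ℝ (Fin d) × EuclideanSpace ℝ (Fin m) =>
      P.g p.1 p.2) (Set.univ ×ˢ P.A)
  lipschitz_f : ∀ a ∈ P.A, LipschitzWith Lf fun x => P.f x a
  lipschitz_g : ∀ a ∈ P.A, LipschitzWith Lg fun x => P.g x a
  norm_f_le : ∀ x, ∀ a ∈ P.A, ‖P.f x a‖ ≤ Mf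
  abs_g_le : ∀ x, ∀ a ∈ P.A, |P.g x a| ≤ Mg
  lt_lam : (Lf : ℝ) < P.lam

namespace ControlProblem

variable {d m : ℕ} {l u : Fin d → ℝ} {P : ControlProblem d m} {Lf Lg : ℝ≥0} {Mf Mg : ℝ}

theorem IsRegular.lam_pos (hP : P.IsRegular Lf Lg Mf Mg) : 0 < P.lam :=
  lt_of_le_of_lt Lf.2 hP.lt_lam

theorem IsRegular.Mf_nonneg (hP : P.IsRegular Lf Lg Mf Mg) : 0 ≤ Mf := by
  obtain ⟨a, ha⟩ := hP.nonempty
  exact (norm_nonneg _).trans (hP.norm_f_le 0 a ha)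

theorem IsRegular.Mg_nonneg (hP : P.IsRegular Lf Lg Mf Mg) : 0 ≤ Mg := by
  obtain ⟨a, ha⟩ := hP.nonempty
  exact (abs_nonneg _).trans (hP.abs_g_le 0 a ha)

theorem discount_pos (P : ControlProblem d m) (t : ℝ) : 0 < P.discount t := Real.exp_pos _

theorem IsRegular.discount_lt_one (hP : P.IsRegular Lf Lg Mf Mg) {t : ℝ} (ht : 0 < t) :
    P.discount t < 1 := by
  rw [discount, Real.exp_lt_one_iff]
  have := mul_pos hP.lam_pos ht
  linarith

/-! ### The Bellman operator and the evaluation of a fixed policy -/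

section Bellman

variable {G : Grid l u} {t : ℝ}

theorem IsRegular.continuousOn_stepCost (hP : P.IsRegular Lf Lg Mf Mg) (V : G.Node → ℝ)
    (i : G.Node) : ContinuousOn (P.stepCost G t V i) P.A := by
  have hm : ContinuousOn (fun a : EuclideanSpace ℝ (Fin m) => (G.point i, a)) P.A := by fun_prop
  have hmap : Set.MapsTo (fun a : EuclideanSpace ℝ (Fin m) => (G.point i, a)) P.A
      (Set.univ ×ˢ P.A) := fun a ha => ⟨trivial, ha⟩
  have h1 := hP.continuousOn_f.comp hm hmap
  have h2 := hP.continuousOn_g.comp hm hmap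
  unfold stepCost
  exact (((G.continuous_interp V).comp_continuousOn
    (continuousOn_const.add (h1.const_smul t))).const_mul _).add (h2.const_mul t)

theorem IsRegular.exists_isMinOn (hP : P.IsRegular Lf Lg Mf Mg) (V : G.Node → ℝ)
    (i : G.Node) : ∃ a ∈ P.A, IsMinOn (P.stepCost G t V i) P.A a :=
  hP.isCompact.exists_isMinOn hP.nonempty (hP.continuousOn_stepCost V i)

theorem bellman_eq_stepCost {V : G.Node → ℝ} {i : G.Node} {a : EuclideanSpace ℝ (Fin m)}
    (ha : a ∈ P.A) (h : IsMinOn (P.stepCost G t V i) P.A a) :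
    P.bellman G t V i = P.stepCost G t V i a :=
  IsLeast.csInf_eq ⟨Set.mem_image_of_mem _ ha, by rintro _ ⟨b, hb, rfl⟩; exact h hb⟩

theorem IsRegular.bellman_le (hP : P.IsRegular Lf Lg Mf Mg) (V : G.Node → ℝ)
    (i : G.Node) {a : EuclideanSpace ℝ (Fin m)} (ha : a ∈ P.A) :
    P.bellman G t V i ≤ P.stepCost G t V i a := by
  obtain ⟨b, hb, hmin⟩ := hP.exists_isMinOn (t := t) V i
  rw [bellman_eq_stepCost hb hmin]
  exact hmin ha

theorem Invariant.abs_stepCost_sub_le (hI : P.Invariant G t) (U V : G.Node → ℝ) (i : G.Node)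
    {a : EuclideanSpace ℝ (Fin m)} (ha : a ∈ P.A) :
    |P.stepCost G t U i a - P.stepCost G t V i a| ≤ P.discount t * ‖U - V‖ := by
  have : P.stepCost G t U i a - P.stepCost G t V i a =
      P.discount t * G.interp (U - V) (G.point i + t • P.f (G.point i) a) := by
    rw [Grid.interp_sub, stepCost, stepCost]; ring
  rw [this, abs_mul, abs_of_pos (P.discount_pos t)]
  exact mul_le_mul_of_nonneg_left
    (G.abs_interp_le (hI i a ha) fun j => norm_le_pi_norm (U - V) j) (P.discount_pos t).le

theorem IsRegular.norm_bellman_sub_le (hP : P.IsRegular Lf Lg Mf Mg) (hI : P.Invariant G t)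
    (U V : G.Node → ℝ) :
    ‖P.bellman G t U - P.bellman G t V‖ ≤ P.discount t * ‖U - V‖ := by
  refine (pi_norm_le_iff_of_nonneg
    (mul_nonneg (P.discount_pos t).le (norm_nonneg _))).2 fun i => ?_
  obtain ⟨a, ha, hmina⟩ := hP.exists_isMinOn (t := t) U i
  obtain ⟨b, hb, hminb⟩ := hP.exists_isMinOn (t := t) V i
  rw [Pi.sub_apply, Real.norm_eq_abs, abs_le]
  have h1 := abs_le.1 (hI.abs_stepCost_sub_le U V i ha)
  have h2 := abs_le.1 (hI.abs_stepCost_sub_le U V i hb)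
  have h3 := hP.bellman_le (t := t) U i hb
  have h4 := hP.bellman_le (t := t) V i ha
  rw [bellman_eq_stepCost ha hmina] at *
  rw [bellman_eq_stepCost hb hminb] at *
  constructor <;> linarith [h1.1, h2.2]

theorem IsRegular.contractingWith_bellman (hP : P.IsRegular Lf Lg Mf Mg) (ht : 0 < t)
    (hI : P.Invariant G t) :
    ContractingWith ⟨P.discount t, (P.discount_pos t).le⟩ (P.bellman G t) :=
  ⟨by exact_mod_cast hP.discount_lt_one ht, LipschitzWith.of_dist_le_mul fun U V => by
    rw [dist_eq_norm, dist_eq_norm]; exact hP.norm_bellman_sub_le hI U V⟩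

theorem IsRegular.exists_isFixedPt_bellman (hP : P.IsRegular Lf Lg Mf Mg) (ht : 0 < t)
    (hI : P.Invariant G t) : ∃ V, Function.IsFixedPt (P.bellman G t) V :=
  ⟨_, (hP.contractingWith_bellman ht hI).fixedPoint_isFixedPt⟩

theorem IsRegular.norm_valueIter_sub_le (hP : P.IsRegular Lf Lg Mf Mg) (hI : P.Invariant G t)
    {V : G.Node → ℝ} (hV : Function.IsFixedPt (P.bellman G t) V) (V0 : G.Node → ℝ) (N : ℕ) :
    ‖P.valueIter G t V0 N - V‖ ≤ P.discount t ^ N * ‖V0 - V‖ := by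
  induction N with
  | zero => simp [valueIter]
  | succ N ih =>
    have e : P.valueIter G t V0 (N + 1) = P.bellman G t (P.valueIter G t V0 N) :=
      Function.iterate_succ_apply' _ _ _
    have h := hP.norm_bellman_sub_le hI (P.valueIter G t V0 N) V
    rw [hV.eq, ← e] at h
    calc _ ≤ P.discount t * (P.discount t ^ N * ‖V0 - V‖) :=
          h.trans (mul_le_mul_of_nonneg_left ih (P.discount_pos t).le)
      _ = _ := by ring

/-- The discrete counterpart of `|v| ≤ Mg / λ`: take norms in the fixed point equation. -/
theorem IsRegular.abs_fixedPt_le (hP : P.IsRegular Lf Lg Mf Mg) (ht : 0 < t)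
    (hI : P.Invariant G t) {V : G.Node → ℝ} (hV : Function.IsFixedPt (P.bellman G t) V)
    (i : G.Node) : (1 - P.discount t) * |V i| ≤ t * Mg := by
  have hg := hP.discount_lt_one ht
  have h : ‖V‖ ≤ P.discount t * ‖V‖ + t * Mg := by
    refine (pi_norm_le_iff_of_nonneg (add_nonneg (mul_nonneg (P.discount_pos t).le
      (norm_nonneg _)) (mul_nonneg ht.le hP.Mg_nonneg))).2 fun i => ?_
    obtain ⟨a, ha, hmin⟩ := hP.exists_isMinOn (t := t) V i
    rw [← congrFun hV.eq i, bellman_eq_stepCost ha hmin, Real.norm_eq_abs, stepCost]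
    refine (abs_add_le _ _).trans (add_le_add ?_ ?_)
    · rw [abs_mul, abs_of_pos (P.discount_pos t)]
      exact mul_le_mul_of_nonneg_left
        (G.abs_interp_le (hI i a ha) fun j => norm_le_pi_norm V j) (P.discount_pos t).le
    · rw [abs_mul, abs_of_pos ht]
      exact mul_le_mul_of_nonneg_left (hP.abs_g_le _ a ha) ht.le
  have h2 : |V i| ≤ ‖V‖ := norm_le_pi_norm V i
  nlinarith

/-- The linear part of the evaluation operator of the policy `a`. -/
noncomputable def policyLin (P : ControlProblem d m) (G : Grid l u) (t : ℝ)
    (a : G.Node → EuclideanSpace ℝ (Fin m)) : (G.Node → ℝ) →L[ℝ] (G.Node → ℝ) :=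
  LinearMap.toContinuousLinearMap
    { toFun := fun U i => P.discount t * G.interp U (G.point i + t • P.f (G.point i) (a i))
      map_add' := fun U V => by
        ext i
        simp only [Grid.interp_eq, Pi.add_apply, add_mul, Finset.sum_add_distrib, mul_add]
      map_smul' := fun c U => by
        ext i
        simp only [Grid.interp_eq, Pi.smul_apply, smul_eq_mul, RingHom.id_apply, mul_assoc,
          ← Finset.mul_sum]
        ring }

theorem policyLin_apply (a : G.Node → EuclideanSpace ℝ (Fin m)) (U : G.Node → ℝ) (i : G.Node) :
    P.policyLin G t a U i =
      P.discount t * G.interp U (G.point i + t • P.f (G.point i) (a i)) := rfl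

theorem stepCost_eq_policyLin (a : G.Node → EuclideanSpace ℝ (Fin m)) (U : G.Node → ℝ)
    (i : G.Node) : P.stepCost G t U i (a i) = P.policyLin G t a U i +
      t * P.g (G.point i) (a i) := rfl

theorem Invariant.norm_policyLin_le (hI : P.Invariant G t)
    {a : G.Node → EuclideanSpace ℝ (Fin m)} (ha : ∀ i, a i ∈ P.A) (U : G.Node → ℝ) :
    ‖P.policyLin G t a U‖ ≤ P.discount t * ‖U‖ := by
  refine (pi_norm_le_iff_of_nonneg
    (mul_nonneg (P.discount_pos t).le (norm_nonneg _))).2 fun i => ?_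
  rw [policyLin_apply, Real.norm_eq_abs, abs_mul, abs_of_pos (P.discount_pos t)]
  exact mul_le_mul_of_nonneg_left
    (G.abs_interp_le (hI i _ (ha i)) fun j => norm_le_pi_norm U j) (P.discount_pos t).le

/-- Discrete maximum principle for the evaluation operator of a policy. -/
theorem Invariant.nonpos_of_le_policyLin (hI : P.Invariant G t) (ht : P.discount t < 1)
    {a : G.Node → EuclideanSpace ℝ (Fin m)} (ha : ∀ i, a i ∈ P.A) {U : G.Node → ℝ}
    (h : ∀ i, U i ≤ P.policyLin G t a U i) (i : G.Node) : U i ≤ 0 := by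
  have : Nonempty G.Node := ⟨i⟩
  obtain ⟨j, hj⟩ := Finite.exists_max U
  have h1 : U j ≤ P.discount t * U j := (h j).trans
    (mul_le_mul_of_nonneg_left (G.interp_le (hI j _ (ha j)) hj) (P.discount_pos t).le)
  have h2 := hj i
  nlinarith

theorem policyLin_mono (a : G.Node → EuclideanSpace ℝ (Fin m)) {U V : G.Node → ℝ}
    (h : ∀ i, U i ≤ V i) (i : G.Node) : P.policyLin G t a U i ≤ P.policyLin G t a V i :=
  mul_le_mul_of_nonneg_left (G.interp_mono h _) (P.discount_pos t).le

/-- Policy evaluation: the linear equation of a policy is solvable. -/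
theorem Invariant.exists_policy_eval (hI : P.Invariant G t) (ht : P.discount t < 1)
    {a : G.Node → EuclideanSpace ℝ (Fin m)} (ha : ∀ i, a i ∈ P.A) :
    ∃ U : G.Node → ℝ, ∀ i, U i = P.stepCost G t U i (a i) := by
  have hc : ContractingWith ⟨P.discount t, (P.discount_pos t).le⟩
      (fun (U : G.Node → ℝ) i => P.stepCost G t U i (a i)) := by
    refine ⟨by exact_mod_cast ht, LipschitzWith.of_dist_le_mul fun U V => ?_⟩
    rw [dist_eq_norm, dist_eq_norm]
    exact (pi_norm_le_iff_of_nonneg (mul_nonneg (P.discount_pos t).le (norm_nonneg _))).2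
      fun i => hI.abs_stepCost_sub_le U V i (ha i)
  exact ⟨_, fun i => (congrFun hc.fixedPoint_isFixedPt i).symm⟩

end Bellman

/-! ### Monotone convergence of policy iteration and the derivative of the residual -/

section PolicyIteration

variable {G : Grid l u} {t : ℝ}

theorem IsRegular.exists_isPolicyIteration (hP : P.IsRegular Lf Lg Mf Mg) (ht : 0 < t)
    (hI : P.Invariant G t) (W0 : G.Node → ℝ) : ∃ W, P.IsPolicyIteration G t W ∧ W 0 = W0 := by
  choose a ha hmin using fun (U : G.Node → ℝ) i => hP.exists_isMinOn (t := t) U i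
  choose S hS using fun U : G.Node → ℝ =>
    hI.exists_policy_eval (hP.discount_lt_one ht) (ha U)
  refine ⟨fun n => S^[n] W0, ⟨fun n => a (S^[n] W0), fun n i => ⟨ha _ i, hmin _ i, ?_⟩⟩, rfl⟩
  simp only [Function.iterate_succ_apply']
  exact hS _ i

variable {V : G.Node → ℝ} {W : ℕ → G.Node → ℝ} {a : ℕ → G.Node → EuclideanSpace ℝ (Fin m)}

/-- `V` is a subsolution of the linear equation of any policy, so the maximum principle applies to
the difference. The index starts at one because `W 0` is arbitrary. -/
theorem IsRegular.fixedPt_le_policyIteration (hP : P.IsRegular Lf Lg Mf Mg) (ht : 0 < t)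
    (hI : P.Invariant G t) (hV : Function.IsFixedPt (P.bellman G t) V)
    (hW : ∀ n i, a n i ∈ P.A ∧ IsMinOn (P.stepCost G t (W n) i) P.A (a n i) ∧
      W (n + 1) i = P.stepCost G t (W (n + 1)) i (a n i)) (n : ℕ) (i : G.Node) :
    V i ≤ W (n + 1) i := by
  have h := hI.nonpos_of_le_policyLin (hP.discount_lt_one ht) (fun i => (hW n i).1)
    (U := V - W (n + 1)) (fun j => ?_) i
  · simpa using h
  · have h1 := (hW n j).2.2
    have h2 := hP.bellman_le (t := t) V j (hW n j).1
    rw [stepCost_eq_policyLin] at h1 h2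
    rw [congrFun hV.eq j] at h2
    rw [map_sub, Pi.sub_apply, Pi.sub_apply]
    linarith

/-- Policy improvement: `W (n + 1)` solves the equation of the old policy, hence is a supersolution
for the new greedy one. -/
theorem IsRegular.policyIteration_succ_le (hP : P.IsRegular Lf Lg Mf Mg) (ht : 0 < t)
    (hI : P.Invariant G t)
    (hW : ∀ n i, a n i ∈ P.A ∧ IsMinOn (P.stepCost G t (W n) i) P.A (a n i) ∧
      W (n + 1) i = P.stepCost G t (W (n + 1)) i (a n i)) (n : ℕ) (i : G.Node) :
    W (n + 2) i ≤ W (n + 1) i := by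
  have h := hI.nonpos_of_le_policyLin (hP.discount_lt_one ht) (fun i => (hW (n + 1) i).1)
    (U := W (n + 2) - W (n + 1)) (fun j => ?_) i
  · simpa using h
  · have h1 := (hW (n + 1) j).2.2
    have h2 : P.stepCost G t (W (n + 1)) j (a (n + 1) j) ≤
      P.stepCost G t (W (n + 1)) j (a n j) := (hW (n + 1) j).2.1 (hW n j).1
    have h3 := (hW n j).2.2
    rw [← h3, stepCost_eq_policyLin] at h2
    rw [stepCost_eq_policyLin] at h1
    rw [map_sub, Pi.sub_apply, Pi.sub_apply]
    linarith

/-- By monotonicity `V ≤ W (n + 2) ≤ T (W (n + 1))`: a policy step is at least as good as a value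
step, and `T` contracts. -/
theorem IsRegular.norm_policyIteration_sub_le (hP : P.IsRegular Lf Lg Mf Mg) (ht : 0 < t)
    (hI : P.Invariant G t) (hV : Function.IsFixedPt (P.bellman G t) V)
    (hW : ∀ n i, a n i ∈ P.A ∧ IsMinOn (P.stepCost G t (W n) i) P.A (a n i) ∧
      W (n + 1) i = P.stepCost G t (W (n + 1)) i (a n i)) (n : ℕ) :
    ‖W (n + 2) - V‖ ≤ P.discount t * ‖W (n + 1) - V‖ := by
  refine (pi_norm_le_iff_of_nonneg
    (mul_nonneg (P.discount_pos t).le (norm_nonneg _))).2 fun i => ?_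
  rw [Pi.sub_apply, Real.norm_eq_abs, abs_of_nonneg
    (sub_nonneg.2 (hP.fixedPt_le_policyIteration ht hI hV hW (n + 1) i))]
  have h1 := (hW (n + 1) i).2.2
  have h2 := policyLin_mono (P := P) (t := t) (a (n + 1))
    (hP.policyIteration_succ_le ht hI hW n) i
  have h3 := bellman_eq_stepCost (hW (n + 1) i).1 (hW (n + 1) i).2.1
  have h4 := (le_abs_self _).trans
    ((norm_le_pi_norm _ i).trans (hP.norm_bellman_sub_le hI (W (n + 1)) V))
  rw [Pi.sub_apply, congrFun hV.eq i] at h4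
  rw [stepCost_eq_policyLin] at h1 h3
  linarith

theorem IsRegular.tendsto_policyIteration (hP : P.IsRegular Lf Lg Mf Mg) (ht : 0 < t)
    (hI : P.Invariant G t) (hV : Function.IsFixedPt (P.bellman G t) V)
    (hW : ∀ n i, a n i ∈ P.A ∧ IsMinOn (P.stepCost G t (W n) i) P.A (a n i) ∧
      W (n + 1) i = P.stepCost G t (W (n + 1)) i (a n i)) :
    Filter.Tendsto W Filter.atTop (nhds V) := by
  have hb : ∀ n, ‖W (n + 1) - V‖ ≤ P.discount t ^ n * ‖W 1 - V‖ := by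
    intro n
    induction n with
    | zero => simp
    | succ n ih =>
      calc _ ≤ P.discount t * (P.discount t ^ n * ‖W 1 - V‖) :=
            (hP.norm_policyIteration_sub_le ht hI hV hW n).trans
              (mul_le_mul_of_nonneg_left ih (P.discount_pos t).le)
        _ = _ := by ring
  rw [← Filter.tendsto_add_atTop_iff_nat 1, tendsto_iff_norm_sub_tendsto_zero]
  refine squeeze_zero (fun _ => norm_nonneg _) hb ?_
  have := (tendsto_pow_atTop_nhds_zero_of_lt_one (P.discount_pos t).le
    (hP.discount_lt_one ht)).mul_const ‖W 1 - V‖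
  rwa [zero_mul] at this

/-- At a point of differentiability of the Bellman operator, its derivative is the linear part of
the evaluation operator of any greedy policy. -/
theorem IsRegular.fderiv_residual (hP : P.IsRegular Lf Lg Mf Mg) {U : G.Node → ℝ}
    (hU : DifferentiableAt ℝ (fun U => U - P.bellman G t U) U)
    {b : G.Node → EuclideanSpace ℝ (Fin m)}
    (hb : ∀ i, b i ∈ P.A ∧ IsMinOn (P.stepCost G t U i) P.A (b i)) :
    fderiv ℝ (fun U => U - P.bellman G t U) U =
      ContinuousLinearMap.id ℝ _ - P.policyLin G t b := by
  set F := fun U => U - P.bellman G t U with hF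
  have hF' := hU.hasFDerivAt
  have hL : HasFDerivAt (fun U : G.Node → ℝ => U - P.policyLin G t b U)
      (ContinuousLinearMap.id ℝ _ - P.policyLin G t b) U :=
    (hasFDerivAt_id U).sub (P.policyLin G t b).hasFDerivAt
  have hd := hF'.sub hL
  have h0 : fderiv ℝ F U - (ContinuousLinearMap.id ℝ _ - P.policyLin G t b) = 0 := by
    ext z i
    have hi := (hasFDerivAt_pi'.1 hd) i
    -- The policy is admissible for every `X` and optimal at `U`, so this component is minimal at
    -- `U` and its derivative vanishes there.
    have hmin : IsLocalMin (fun x : G.Node → ℝ => (F x - (x - P.policyLin G t b x)) i) U := by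
      refine Filter.Eventually.of_forall fun X => ?_
      have h1 := hP.bellman_le (t := t) X i (hb i).1
      have h2 := bellman_eq_stepCost (hb i).1 (hb i).2
      rw [stepCost_eq_policyLin] at h1 h2
      simp only [hF, Pi.sub_apply]
      linarith
    have := hmin.hasFDerivAt_eq_zero hi
    exact congrArg (fun L => L z) this
  exact sub_eq_zero.1 h0

end PolicyIteration

end ControlProblem

/-! ### Newton-Kantorovich theory in affine covariant form -/

namespace NewtonAssumptions

variable {X Y : Type*} [NormedAddCommGroup X] [NormedSpace ℝ X]
    [NormedAddCommGroup Y] [NormedSpace ℝ Y] {F : X → Y} {D : Set X} {x₀ : X} {α ω : ℝ}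

theorem differentiableAt (h : NewtonAssumptions F D x₀ α ω) {x : X} (hx : x ∈ D) :
    DifferentiableAt ℝ F x :=
  (h.contDiffOn.contDiffAt (h.isOpen.mem_nhds hx)).differentiableAt one_ne_zero

theorem norm_inverse_fderiv_sub_le (h : NewtonAssumptions F D x₀ α ω) {x y : X} (hx : x ∈ D)
    (hy : y ∈ D) (z : X) :
    ‖(fderiv ℝ F x₀).inverse (fderiv ℝ F y z - fderiv ℝ F x z)‖ ≤ ω * ‖y - x‖ * ‖z‖ := by
  have h1 := ((fderiv ℝ F x₀).inverse.comp (fderiv ℝ F y - fderiv ℝ F x)).le_opNorm z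
  exact h1.trans (mul_le_mul_of_nonneg_right (h.lipschitz x hx y hy) (norm_nonneg z))

/-- Quadratic bound for the affine covariant remainder of the linearization. -/
theorem norm_inverse_remainder_le (h : NewtonAssumptions F D x₀ α ω) {x y : X} (hx : x ∈ D)
    (hy : y ∈ D) :
    ‖(fderiv ℝ F x₀).inverse (F y - F x - fderiv ℝ F x (y - x))‖ ≤ ω / 2 * ‖y - x‖ ^ 2 := by
  set R := (fderiv ℝ F x₀).inverse
  have hseg : ∀ s ∈ Set.Icc (0 : ℝ) 1, x + s • (y - x) ∈ D := fun s hs =>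
    h.convex.add_smul_sub_mem hx hy hs
  have hder : ∀ s ∈ Set.Icc (0 : ℝ) 1, HasDerivAt
      (fun s : ℝ => R (F (x + s • (y - x)) - F x - s • fderiv ℝ F x (y - x)))
      (R (fderiv ℝ F (x + s • (y - x)) (y - x) - fderiv ℝ F x (y - x))) s := by
    intro s hs
    have h1 : HasDerivAt (fun s : ℝ => x + s • (y - x)) (y - x) s := by
      simpa using ((hasDerivAt_id s).smul_const (y - x)).const_add x
    have h2 := (h.differentiableAt (hseg s hs)).hasFDerivAt.comp_hasDerivAt s h1
    have h3 : HasDerivAt (fun s : ℝ => s • fderiv ℝ F x (y - x)) (fderiv ℝ F x (y - x)) s := by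
      simpa using (hasDerivAt_id s).smul_const (fderiv ℝ F x (y - x))
    exact R.hasFDerivAt.comp_hasDerivAt s ((h2.sub_const (F x)).sub h3)
  -- The remainder along the segment has derivative of norm at most `ω s ‖y - x‖²`; `B` is the
  -- primitive of this bound.
  have key := image_norm_le_of_norm_deriv_right_le_deriv_boundary
    (B := fun s => ω / 2 * ‖y - x‖ ^ 2 * s ^ 2) (B' := fun s => ω * ‖y - x‖ ^ 2 * s)
    (fun s hs => (hder s hs).continuousAt.continuousWithinAt)
    (fun s hs => (hder s (Set.Ico_subset_Icc_self hs)).hasDerivWithinAt)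
    (by simp)
    (fun s => ((hasDerivAt_pow 2 s).const_mul (ω / 2 * ‖y - x‖ ^ 2)).congr_deriv (by
      push_cast; ring))
    (fun s hs => by
      refine (h.norm_inverse_fderiv_sub_le hx (hseg s (Set.Ico_subset_Icc_self hs)) _).trans ?_
      rw [add_sub_cancel_left, norm_smul, Real.norm_of_nonneg hs.1]
      exact le_of_eq (by ring))
    (Set.right_mem_Icc.2 zero_le_one)
  simpa using key

/-- Needed at the limit of the iterates, which is only known to lie in the closure of `D`; both
sides are continuous in `y`. -/
theorem norm_inverse_remainder_le_of_mem_closure (h : NewtonAssumptions F D x₀ α ω)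
    (hF : Continuous F) {x y : X} (hx : x ∈ D) (hy : y ∈ closure D) :
    ‖(fderiv ℝ F x₀).inverse (F y - F x - fderiv ℝ F x (y - x))‖ ≤ ω / 2 * ‖y - x‖ ^ 2 := by
  have hc : IsClosed {y | ‖(fderiv ℝ F x₀).inverse (F y - F x - fderiv ℝ F x (y - x))‖ ≤
      ω / 2 * ‖y - x‖ ^ 2} := isClosed_le (by fun_prop) (by fun_prop)
  exact closure_minimal (fun y hy => h.norm_inverse_remainder_le hx hy) hc hy

/-- Newton iterates stay in the domain (Newton-Kantorovich majorant argument). -/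
theorem newton_mem (h : NewtonAssumptions F D x₀ α ω) {W : ℕ → X} (h0 : W 0 = x₀)
    (hW : ∀ n, W n ∈ D → fderiv ℝ F (W n) (W (n + 1) - W n) = -F (W n)) (n : ℕ) : W n ∈ D := by
  have hα : 0 ≤ α := (norm_nonneg _).trans h.norm_step_le
  have hω := h.omega_pos
  have hinv := h.invertible
  have hstep : ‖W 1 - x₀‖ ≤ α := by
    have e := hW 0 (by rw [h0]; exact h.mem)
    rw [h0] at e
    rw [← hinv.inverse_apply_self (W 1 - x₀), e, map_neg, norm_neg]
    exact h.norm_step_le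
  -- For `α = 0` the Kantorovich ball is empty and gives nothing, but then `x₀` is already a zero
  -- and the iteration is stationary.
  rcases hα.eq_or_lt with hα0 | hα0
  · have hF0 : F x₀ = 0 := by
      have h1 := h.norm_step_le
      rw [← hα0, norm_le_zero_iff] at h1
      rw [← hinv.self_apply_inverse (F x₀), h1, map_zero]
    have : ∀ n, W n = x₀ := by
      intro n
      induction n with
      | zero => exact h0
      | succ n ih =>
        have e := hW n (by rw [ih]; exact h.mem)
        rw [ih, hF0, neg_zero] at e
        have e2 := hinv.inverse_apply_self (W (n + 1) - x₀)
        rw [e, map_zero] at e2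
        exact sub_eq_zero.1 e2.symm
    rw [this n]
    exact h.mem
  set r := (1 - √(1 - 2 * (α * ω))) / ω with hr
  have hsq : √(1 - 2 * (α * ω)) ^ 2 = 1 - 2 * (α * ω) :=
    Real.sq_sqrt (by linarith [h.kantorovich])
  have hωr : ω * r = 1 - √(1 - 2 * (α * ω)) := by rw [hr]; field_simp
  have hωr1 : ω * r ≤ 1 := by rw [hωr]; linarith [Real.sqrt_nonneg (1 - 2 * (α * ω))]
  -- `r` is the smaller root of the majorant `q t = ω / 2 * t ^ 2 - t + α`.
  have hroot : ω / 2 * r ^ 2 - r + α = 0 := by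
    have : ω * (ω / 2 * r ^ 2 - r + α) = 0 := by
      have e : √(1 - 2 * (α * ω)) = 1 - ω * r := by linarith
      rw [e] at hsq
      nlinarith
    exact (mul_eq_zero.1 this).resolve_left hω.ne'
  have hr0 : 0 < r := by nlinarith [sq_nonneg r]
  have hball : ∀ {x : X} {s : ℝ}, ‖x - x₀‖ ≤ s → s < r → x ∈ D := fun {x s} hx hs =>
    h.ball_subset (by rw [Metric.mem_ball, dist_eq_norm]; exact hx.trans_lt hs)
  -- Here `t` is the scalar Newton iterate for `q` started at `0`, and the bound on the step is the
  -- scalar step `-q t / q' t`.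
  suffices H : ∀ n, ∃ t, 0 ≤ t ∧ t < r ∧ ‖W n - x₀‖ ≤ t ∧
      ‖W (n + 1) - W n‖ ≤ (ω / 2 * t ^ 2 - t + α) / (1 - ω * t) by
    obtain ⟨t, -, ht, hn, -⟩ := H n
    exact hball hn ht
  intro n
  induction n with
  | zero => exact ⟨0, le_rfl, hr0, by simp [h0], by simpa [h0] using hstep⟩
  | succ n ih =>
    obtain ⟨t, ht0, htr, hn, hs⟩ := ih
    have hq : 0 < 1 - ω * t := by nlinarith
    set s := (ω / 2 * t ^ 2 - t + α) / (1 - ω * t) with hsdef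
    have hs0 : 0 ≤ s := (norm_nonneg _).trans hs
    have hsq' : s * (1 - ω * t) = ω / 2 * t ^ 2 - t + α := by rw [hsdef]; field_simp
    have htr' : t + s < r := by
      -- Convexity of `q`: scalar Newton iterates never reach the root. Strictness matters since the
      -- ball is open.
      have e : (r - (t + s)) * (1 - ω * t) = ω / 2 * (r - t) ^ 2 := by
        linear_combination -hroot - hsq'
      have : 0 < (r - (t + s)) * (1 - ω * t) := by
        rw [e]; exact mul_pos (half_pos hω) (pow_pos (sub_pos.2 htr) 2)
      linarith [pos_of_mul_pos_left this hq.le]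
    have hn' : ‖W (n + 1) - x₀‖ ≤ t + s := by
      calc ‖W (n + 1) - x₀‖ = ‖(W n - x₀) + (W (n + 1) - W n)‖ := by congr 1; abel
        _ ≤ _ := (norm_add_le _ _).trans (add_le_add hn hs)
    have hD := hball hn htr
    have hD' := hball hn' htr'
    have hq' : 0 < 1 - ω * (t + s) := by nlinarith
    refine ⟨t + s, by linarith, htr', hn', ?_⟩
    rw [le_div_iff₀ hq']
    have e1 := h.norm_inverse_remainder_le hD hD'
    rw [hW n hD, sub_neg_eq_add, sub_add_cancel] at e1
    -- Replacing the derivative at `W (n + 1)` by the one at `x₀` costs at most `ω (t + s) ‖z‖`,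
    -- which is absorbed on the left; invertibility at `W (n + 1)` is not needed.
    have e2 := h.norm_inverse_fderiv_sub_le h.mem hD' (W (n + 1 + 1) - W (n + 1))
    rw [hW (n + 1) hD', map_sub, hinv.inverse_apply_self, map_neg] at e2
    set z := W (n + 1 + 1) - W (n + 1)
    have e3 : ‖z‖ ≤ ‖(fderiv ℝ F x₀).inverse (F (W (n + 1)))‖ +
        ‖-(fderiv ℝ F x₀).inverse (F (W (n + 1))) - z‖ := by
      have := norm_add_le (-(fderiv ℝ F x₀).inverse (F (W (n + 1))))
        (-(-(fderiv ℝ F x₀).inverse (F (W (n + 1))) - z))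
      rw [norm_neg, norm_neg] at this
      rwa [show -(fderiv ℝ F x₀).inverse (F (W (n + 1))) +
        -(-(fderiv ℝ F x₀).inverse (F (W (n + 1))) - z) = z by abel] at this
    have e4 : ω * ‖W (n + 1) - x₀‖ * ‖z‖ ≤ ω * (t + s) * ‖z‖ := by gcongr
    have e5 : ω / 2 * ‖W (n + 1) - W n‖ ^ 2 ≤ ω / 2 * s ^ 2 := by gcongr
    have e6 : ω / 2 * (t + s) ^ 2 - (t + s) + α = ω / 2 * s ^ 2 := by
      linear_combination -hsq'
    rw [e6]
    linarith

end NewtonAssumptions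

/-! ### Accumulated quadratic convergence -/

/-- The product on the right is `μ^(M(M-1)+1) ρ^(2M)`. As `μ` may exceed one, each of the `x`
surplus factors `μ` on the left is paired with a factor `ρ`; the remaining `y` factors `ρ` are
dropped. That `x, y ≥ 0` amounts to `M(M-1) + 2 ≤ 2^M` and `2M ≤ M(M-1) + 2`. -/
theorem pow_bound_le_prod {μ ρ : ℝ} (hμ : 0 ≤ μ) (hρ : 0 ≤ ρ) (hρ1 : ρ < 1) (hμρ : μ * ρ < 1)
    {M : ℕ} (hM : 1 ≤ M) :
    μ ^ (2 ^ M - 1) * ρ ^ 2 ^ M ≤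
      μ * ∏ k ∈ Finset.Icc 1 M, (μ ^ (2 * (k - 1)) * ρ ^ 2) := by
  have hprod : ∀ M : ℕ, ∏ k ∈ Finset.Icc 1 M, (μ ^ (2 * (k - 1)) * ρ ^ 2) =
      μ ^ (M * (M - 1)) * ρ ^ (2 * M) := by
    intro M
    induction M with
    | zero => simp
    | succ M ih =>
      rw [Finset.prod_Icc_succ_top (by omega), ih, Nat.add_sub_cancel]
      have e : (M + 1) * M = M * (M - 1) + 2 * M := by
        cases M with
        | zero => rfl
        | succ k => rw [Nat.add_sub_cancel]; ring
      rw [e, pow_add, show 2 * (M + 1) = 2 * M + 2 by ring, pow_add]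
      ring
  rw [hprod, ← mul_assoc, ← pow_succ']
  have h1 : ∀ k : ℕ, (k + 1) * k + 2 ≤ 2 ^ (k + 1) := by
    intro k
    induction k with
    | zero => norm_num
    | succ k ih =>
      rcases k with _ | _ | k
      · norm_num
      · norm_num
      · rw [pow_succ]; nlinarith
  obtain ⟨k, rfl⟩ : ∃ k, M = k + 1 := ⟨M - 1, by omega⟩
  have hk := h1 k
  rw [Nat.add_sub_cancel]
  obtain ⟨x, hx⟩ : ∃ x, 2 ^ (k + 1) = (k + 1) * k + 2 + x := ⟨_, (Nat.add_sub_cancel' hk).symm⟩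
  have hy : ∃ y, 2 ^ (k + 1) = 2 * (k + 1) + x + y := by
    refine ⟨(k + 1) * k + 2 - 2 * (k + 1), ?_⟩
    have : 2 * (k + 1) ≤ (k + 1) * k + 2 := by
      rcases k with _ | k
      · norm_num
      · nlinarith
    omega
  obtain ⟨y, hy⟩ := hy
  have e1 : 2 ^ (k + 1) - 1 = ((k + 1) * k + 1) + x := by omega
  rw [e1, hy, pow_add μ, pow_add ρ, pow_add ρ]
  have h2 : (μ * ρ) ^ x ≤ 1 := pow_le_one₀ (mul_nonneg hμ hρ) hμρ.le
  have h3 : ρ ^ y ≤ 1 := pow_le_one₀ hρ hρ1.le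
  calc _ = μ ^ ((k + 1) * k + 1) * ρ ^ (2 * (k + 1)) * ((μ * ρ) ^ x * ρ ^ y) := by
        rw [mul_pow]; ring
    _ ≤ μ ^ ((k + 1) * k + 1) * ρ ^ (2 * (k + 1)) * (1 * 1) := by gcongr
    _ = _ := by ring

theorem le_pow_of_quadratic {e : ℕ → ℝ} {μ ρ : ℝ} (hμ : 0 ≤ μ) (he : ∀ n, 0 ≤ e n)
    (h0 : e 0 ≤ ρ) (h : ∀ n, e (n + 1) ≤ μ * e n ^ 2) (n : ℕ) :
    e n ≤ μ ^ (2 ^ n - 1) * ρ ^ 2 ^ n := by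
  induction n with
  | zero => simpa using h0
  | succ n ih =>
    calc e (n + 1) ≤ μ * (μ ^ (2 ^ n - 1) * ρ ^ 2 ^ n) ^ 2 :=
          (h n).trans (mul_le_mul_of_nonneg_left (pow_le_pow_left₀ (he n) ih 2) hμ)
      _ = μ ^ ((2 ^ n - 1) * 2 + 1) * ρ ^ (2 ^ n * 2) := by
          rw [mul_pow, ← pow_mul, ← pow_mul, pow_succ]; ring
      _ = _ := by
          have : 1 ≤ 2 ^ n := Nat.one_le_two_pow
          rw [show (2 ^ n - 1) * 2 + 1 = 2 ^ (n + 1) - 1 by rw [pow_succ]; omega, ← pow_succ]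

/-! ### Policy iteration as Newton's method -/

namespace ControlProblem

variable {d m : ℕ} {l u : Fin d → ℝ} {P : ControlProblem d m} {Lf Lg : ℝ≥0} {Mf Mg : ℝ}
  {G : Grid l u} {t : ℝ} {V : G.Node → ℝ} {W : ℕ → G.Node → ℝ}

/-- Policy iteration is Newton's method for the residual of the Bellman equation. -/
theorem IsRegular.policyIteration_newton_step (hP : P.IsRegular Lf Lg Mf Mg)
    {a : ℕ → G.Node → EuclideanSpace ℝ (Fin m)}
    (hW : ∀ n i, a n i ∈ P.A ∧ IsMinOn (P.stepCost G t (W n) i) P.A (a n i) ∧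
      W (n + 1) i = P.stepCost G t (W (n + 1)) i (a n i)) {n : ℕ}
    (hd : DifferentiableAt ℝ (fun U => U - P.bellman G t U) (W n)) :
    fderiv ℝ (fun U => U - P.bellman G t U) (W n) (W (n + 1) - W n) =
      -(W n - P.bellman G t (W n)) := by
  rw [hP.fderiv_residual hd fun i => ⟨(hW n i).1, (hW n i).2.1⟩]
  ext i
  have h1 := (hW n i).2.2
  have h2 := bellman_eq_stepCost (hW n i).1 (hW n i).2.1
  rw [stepCost_eq_policyLin] at h1 h2
  simp only [sub_apply, ContinuousLinearMap.id_apply, map_sub, Pi.sub_apply,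
    Pi.neg_apply]
  linarith

theorem IsRegular.policyIteration_quadratic (hP : P.IsRegular Lf Lg Mf Mg) (ht : 0 < t)
    (hI : P.Invariant G t) (hV : Function.IsFixedPt (P.bellman G t) V)
    {D : Set (G.Node → ℝ)} {α ω : ℝ}
    (hN : NewtonAssumptions (fun U => U - P.bellman G t U) D (W 0) α ω)
    (hW : P.IsPolicyIteration G t W) (n : ℕ) :
    ‖W (n + 1) - V‖ ≤
      (1 + P.discount t) / (1 - P.discount t) * (ω / 2) * ‖W n - V‖ ^ 2 := by
  obtain ⟨a, hW⟩ := hW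
  have hγ := hP.discount_lt_one ht
  set F := fun U => U - P.bellman G t U with hF
  have hmem : ∀ n, W n ∈ D := hN.newton_mem rfl fun n hn =>
    hP.policyIteration_newton_step hW (hN.differentiableAt hn)
  have hVD : V ∈ closure D := mem_closure_of_tendsto
    (hP.tendsto_policyIteration ht hI hV hW) (Filter.Eventually.of_forall hmem)
  have hFc : Continuous F :=
    continuous_id.sub (hP.contractingWith_bellman ht hI).toLipschitzWith.continuous
  have hFV : F V = 0 := by simp [hF, hV.eq]
  have e1 := hN.norm_inverse_remainder_le_of_mem_closure hFc (hmem n) hVD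
  have e2 := hP.policyIteration_newton_step hW (hN.differentiableAt (hmem n))
  set R := (fderiv ℝ F (W 0)).inverse with hR
  set q := fderiv ℝ F (W n) (W (n + 1) - V) with hq
  -- As `F V = 0`, the Newton equation turns the linearization remainder at `V` into the derivative
  -- applied to the next error.
  have hqe : F V - F (W n) - fderiv ℝ F (W n) (V - W n) = q := by
    have e : q = fderiv ℝ F (W n) (W (n + 1) - W n) - fderiv ℝ F (W n) (V - W n) := by
      rw [hq, ← map_sub]; congr 1; abel
    rw [hFV, e, e2, zero_sub]
  rw [hqe] at e1
  have h0 := hP.fderiv_residual (hN.differentiableAt (hmem 0))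
    fun i => ⟨(hW 0 i).1, (hW 0 i).2.1⟩
  have hn := hP.fderiv_residual (hN.differentiableAt (hmem n))
    fun i => ⟨(hW n i).1, (hW n i).2.1⟩
  -- Undo the preconditioning by `F'(W 0)⁻¹`, using `‖F'(W 0)‖ ≤ 1 + γ`.
  have e3 : ‖q‖ ≤ (1 + P.discount t) * ‖R q‖ := by
    have e : q = R q - P.policyLin G t (a 0) (R q) := by
      have := hN.invertible.self_apply_inverse q
      rw [← hR, h0] at this
      exact this.symm
    calc ‖q‖ = ‖R q - P.policyLin G t (a 0) (R q)‖ := congrArg _ e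
      _ ≤ ‖R q‖ + P.discount t * ‖R q‖ := (norm_sub_le _ _).trans
          (add_le_add le_rfl (hI.norm_policyLin_le (fun i => (hW 0 i).1) _))
      _ = _ := by ring
  -- The identity minus a map of norm at most `γ` is bounded below by `1 - γ`.
  have e4 : (1 - P.discount t) * ‖W (n + 1) - V‖ ≤ ‖q‖ := by
    have e : q = (W (n + 1) - V) - P.policyLin G t (a n) (W (n + 1) - V) := by
      rw [hq, hn]; rfl
    have h1 := hI.norm_policyLin_le (fun i => (hW n i).1) (W (n + 1) - V)
    have h2 := norm_sub_norm_le (W (n + 1) - V) (P.policyLin G t (a n) (W (n + 1) - V))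
    rw [← e] at h2
    linarith
  rw [norm_sub_rev V] at e1
  have hpos : 0 < 1 - P.discount t := by linarith
  rw [div_mul_eq_mul_div, div_mul_eq_mul_div, le_div_iff₀ hpos]
  have := mul_le_mul_of_nonneg_left e1 (by linarith [P.discount_pos t] : 0 ≤ 1 + P.discount t)
  linarith

end ControlProblem

/-! ### Trajectories: measurability, existence, stability, concatenation -/

open MeasureTheory in
theorem intervalIntegrable_of_norm_le {E : Type*} [NormedAddCommGroup E] {F : ℝ → E}
    (hF : AEStronglyMeasurable F (volume.restrict (Set.Ici 0))) {C : ℝ}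
    (hC : ∀ s, 0 ≤ s → ‖F s‖ ≤ C) {a b : ℝ} (ha : 0 ≤ a) (hb : 0 ≤ b) :
    IntervalIntegrable F volume a b := by
  have hsub : Set.uIoc a b ⊆ Set.Ici 0 := fun s hs => (le_min ha hb).trans hs.1.le
  refine (intervalIntegrable_const (c := C)).mono_fun' (hF.mono_set hsub) ?_
  filter_upwards [ae_restrict_mem measurableSet_uIoc] with s hs
  exact hC s (hsub hs)

theorem ContinuousOn.measurable_comp_of_forall_mem {X Y : Type*} [TopologicalSpace X]
    [MeasurableSpace X] [OpensMeasurableSpace X] [TopologicalSpace Y] [MeasurableSpace Y]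
    [BorelSpace Y] {F : X → Y} {S : Set X} (hF : ContinuousOn F S) {φ : ℝ → X}
    (hφ : Measurable φ) (hS : ∀ t, φ t ∈ S) : Measurable fun t => F (φ t) :=
  hF.domRestrict.measurable.comp (hφ.subtype_mk (h := hS))

namespace ControlProblem

open MeasureTheory

variable {d m : ℕ} {P : ControlProblem d m} {Lf Lg : ℝ≥0} {Mf Mg : ℝ}
  {α : ℝ → EuclideanSpace ℝ (Fin m)} {y : ℝ → EuclideanSpace ℝ (Fin d)}
  {x : EuclideanSpace ℝ (Fin d)}

/-- Controls take values in `A`, where the data are continuous, only at nonnegative times; `max s 0`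
freezes them before time zero. -/
theorem measurable_comp_of_isAdmissible {Y : Type*} [TopologicalSpace Y] [MeasurableSpace Y]
    [BorelSpace Y] {F : EuclideanSpace ℝ (Fin d) → EuclideanSpace ℝ (Fin m) → Y}
    (hF : ContinuousOn (fun p : EuclideanSpace ℝ (Fin d) × EuclideanSpace ℝ (Fin m) =>
      F p.1 p.2) (Set.univ ×ˢ P.A)) (hα : P.IsAdmissible α)
    {z : ℝ → EuclideanSpace ℝ (Fin d)} (hz : Continuous z) :
    Measurable fun s => F (z s) (α (max s 0)) :=
  hF.measurable_comp_of_forall_mem (φ := fun s => (z s, α (max s 0)))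
    (hz.measurable.prodMk (hα.1.comp (measurable_id.max measurable_const)))
    fun _ => ⟨trivial, hα.2 _ (le_max_right _ _)⟩

theorem aestronglyMeasurable_comp {Y : Type*} [TopologicalSpace Y] [MeasurableSpace Y]
    [BorelSpace Y] [TopologicalSpace.PseudoMetrizableSpace Y] [SecondCountableTopology Y]
    {F : EuclideanSpace ℝ (Fin d) → EuclideanSpace ℝ (Fin m) → Y}
    (hF : ContinuousOn (fun p : EuclideanSpace ℝ (Fin d) × EuclideanSpace ℝ (Fin m) =>
      F p.1 p.2) (Set.univ ×ˢ P.A)) (hα : P.IsAdmissible α) (hy : ContinuousOn y (Set.Ici 0)) :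
    AEStronglyMeasurable (fun s => F (y s) (α s)) (volume.restrict (Set.Ici 0)) := by
  have hz : Continuous fun s => y (max s 0) :=
    hy.comp_continuous (by fun_prop) fun s => Set.mem_Ici.2 (le_max_right _ _)
  refine (measurable_comp_of_isAdmissible hF hα hz).aestronglyMeasurable.congr ?_
  filter_upwards [ae_restrict_mem measurableSet_Ici] with s hs
  rw [max_eq_left hs]

theorem IsRegular.intervalIntegrable_f (hP : P.IsRegular Lf Lg Mf Mg) (hα : P.IsAdmissible α)
    (hy : ContinuousOn y (Set.Ici 0)) {a b : ℝ} (ha : 0 ≤ a) (hb : 0 ≤ b) :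
    IntervalIntegrable (fun s => P.f (y s) (α s)) volume a b :=
  intervalIntegrable_of_norm_le (aestronglyMeasurable_comp hP.continuousOn_f hα hy)
    (fun s hs => hP.norm_f_le _ _ (hα.2 s hs)) ha hb

theorem IsRegular.intervalIntegrable_g (hP : P.IsRegular Lf Lg Mf Mg) (hα : P.IsAdmissible α)
    (hy : ContinuousOn y (Set.Ici 0)) {a b : ℝ} (ha : 0 ≤ a) (hb : 0 ≤ b) :
    IntervalIntegrable (fun s => P.g (y s) (α s)) volume a b :=
  intervalIntegrable_of_norm_le (aestronglyMeasurable_comp hP.continuousOn_g hα hy)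
    (fun s hs => hP.abs_g_le _ _ (hα.2 s hs)) ha hb

theorem IsRegular.integrableOn_cost (hP : P.IsRegular Lf Lg Mf Mg) (hα : P.IsAdmissible α)
    (hy : ContinuousOn y (Set.Ici 0)) :
    IntegrableOn (fun s => P.g (y s) (α s) * Real.exp (-P.lam * s)) (Set.Ioi 0) := by
  refine ((exp_neg_integrableOn_Ioi 0 hP.lam_pos).const_mul Mg).mono' ?_ ?_
  · exact ((aestronglyMeasurable_comp hP.continuousOn_g hα hy).mono_measure
      (Measure.restrict_mono Set.Ioi_subset_Ici_self le_rfl)).mul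
      (by fun_prop : Continuous fun s : ℝ => Real.exp (-P.lam * s)).aestronglyMeasurable
  · filter_upwards [ae_restrict_mem measurableSet_Ioi] with s hs
    rw [norm_mul, Real.norm_of_nonneg (Real.exp_pos _).le]
    exact mul_le_mul_of_nonneg_right (hP.abs_g_le _ _ (hα.2 s (le_of_lt hs))) (Real.exp_pos _).le

/-- Existence of trajectories for measurable controls. -/
theorem IsRegular.exists_isTrajectory (hP : P.IsRegular Lf Lg Mf Mg) (hα : P.IsAdmissible α)
    (x : EuclideanSpace ℝ (Fin d)) : ∃ y, P.IsTrajectory x α y := by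
  -- Picard iteration for `z t = e^{-κ t} (y t - x)`: with this exponential weight and `κ = λ > Lf`
  -- the integral operator contracts by `Lf / κ` on the whole half-line at once.
  set κ := P.lam with hκ
  have hκ0 : 0 < κ := hP.lam_pos
  set F : (BoundedContinuousFunction ℝ (EuclideanSpace ℝ (Fin d))) → ℝ →
    EuclideanSpace ℝ (Fin d) := fun z s => P.f (x + Real.exp (κ * s) • z s) (α (max s 0)) with hF
  have hFb : ∀ z s, ‖F z s‖ ≤ Mf := fun z s => hP.norm_f_le _ _ (hα.2 _ (le_max_right _ _))
  have hFi : ∀ z a b, IntervalIntegrable (F z) volume a b := by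
    intro z a b
    have hm : Measurable (F z) := measurable_comp_of_isAdmissible hP.continuousOn_f hα
      (z := fun s => x + Real.exp (κ * s) • z s) (by fun_prop)
    rw [intervalIntegrable_iff]
    exact Measure.integrableOn_of_bounded (M := Mf) (by simp [Set.uIoc]) hm.aestronglyMeasurable
      (Filter.Eventually.of_forall fun s => hFb z s)
  have hIc : ∀ z, Continuous fun t : ℝ => Real.exp (-κ * max t 0) • ∫ s in (0 : ℝ)..max t 0, F z s
      := fun z => (by fun_prop : Continuous fun t : ℝ => Real.exp (-κ * max t 0)).smul
        ((intervalIntegral.continuous_primitive (fun a b => hFi z a b) 0).comp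
          (by fun_prop : Continuous fun t : ℝ => max t 0))
  have hIb : ∀ z t, ‖Real.exp (-κ * max t 0) • ∫ s in (0 : ℝ)..max t 0, F z s‖ ≤ Mf / κ := by
    intro z t
    have h0 : 0 ≤ max t 0 := le_max_right _ _
    have h1 := intervalIntegral.norm_integral_le_of_norm_le_const (f := F z) (a := 0)
      (b := max t 0) (C := Mf) fun s _ => hFb z s
    rw [sub_zero, abs_of_nonneg h0] at h1
    rw [norm_smul, Real.norm_of_nonneg (Real.exp_pos _).le, neg_mul, Real.exp_neg,
      inv_mul_le_iff₀ (Real.exp_pos _)]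
    refine h1.trans ?_
    have h2 := Real.add_one_le_exp (κ * max t 0)
    rw [mul_div_assoc', le_div_iff₀ hκ0]
    nlinarith [hP.Mf_nonneg]
  let Φ : BoundedContinuousFunction ℝ (EuclideanSpace ℝ (Fin d)) →
      BoundedContinuousFunction ℝ (EuclideanSpace ℝ (Fin d)) := fun z =>
    BoundedContinuousFunction.ofNormedAddCommGroup _ (hIc z) (Mf / κ) (hIb z)
  have hΦ : ∀ z t, Φ z t = Real.exp (-κ * max t 0) • ∫ s in (0 : ℝ)..max t 0, F z s :=
    fun _ _ => rfl
  have hc : ContractingWith (Lf / ⟨κ, hκ0.le⟩) Φ := by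
    refine ⟨?_, LipschitzWith.of_dist_le_mul fun z w => ?_⟩
    · rw [div_lt_one (show (0 : ℝ≥0) < ⟨κ, hκ0.le⟩ from hκ0)]
      exact hP.lt_lam
    · rw [BoundedContinuousFunction.dist_le (by positivity)]
      intro t
      have h0 : 0 ≤ max t 0 := le_max_right _ _
      rw [dist_eq_norm, hΦ, hΦ, ← smul_sub, ← intervalIntegral.integral_sub (hFi z _ _)
        (hFi w _ _), norm_smul, Real.norm_of_nonneg (Real.exp_pos _).le, neg_mul, Real.exp_neg,
        inv_mul_le_iff₀ (Real.exp_pos _)]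
      have hprim : ∫ s in (0 : ℝ)..max t 0, Lf * dist z w * Real.exp (κ * s) =
          Lf * dist z w / κ * Real.exp (κ * max t 0) - Lf * dist z w / κ * Real.exp (κ * 0) := by
        refine intervalIntegral.integral_eq_sub_of_hasDerivAt
          (f := fun s => Lf * dist z w / κ * Real.exp (κ * s)) (fun s _ => ?_)
          (Continuous.intervalIntegrable (by fun_prop) _ _)
        have h1 : HasDerivAt (fun s => Real.exp (κ * s)) (Real.exp (κ * s) * (κ * 1)) s :=
          ((hasDerivAt_id s).const_mul κ).exp
        refine (h1.const_mul (Lf * dist z w / κ)).congr_deriv ?_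
        field_simp
      have h1 : ‖∫ s in (0 : ℝ)..max t 0, (F z s - F w s)‖ ≤
          ∫ s in (0 : ℝ)..max t 0, Lf * dist z w * Real.exp (κ * s) := by
        refine intervalIntegral.norm_integral_le_of_norm_le h0
          (Filter.Eventually.of_forall fun s _ => ?_)
          (Continuous.intervalIntegrable (by fun_prop) _ _)
        have h2 := (hP.lipschitz_f _ (hα.2 (max s 0) (le_max_right _ _))).dist_le_mul
          (x + Real.exp (κ * s) • z s) (x + Real.exp (κ * s) • w s)
        rw [dist_add_left, dist_smul₀, Real.norm_of_nonneg (Real.exp_pos _).le,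
          dist_eq_norm] at h2
        refine h2.trans ?_
        have h3 := z.dist_coe_le_dist (g := w) s
        calc (Lf : ℝ) * (Real.exp (κ * s) * dist (z s) (w s))
            ≤ Lf * (Real.exp (κ * s) * dist z w) := by gcongr
          _ = _ := by ring
      refine h1.trans ?_
      rw [hprim]
      have : 0 ≤ Lf * dist z w / κ * Real.exp (κ * 0) := by positivity
      change _ ≤ Real.exp (κ * max t 0) * ((Lf : ℝ) / κ * dist z w)
      have e : Real.exp (κ * max t 0) * ((Lf : ℝ) / κ * dist z w) =
        Lf * dist z w / κ * Real.exp (κ * max t 0) := by ring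
      linarith
  obtain ⟨z, hz⟩ : ∃ z, Φ z = z := ⟨_, hc.fixedPoint_isFixedPt⟩
  refine ⟨fun t => x + Real.exp (κ * t) • z t, by fun_prop, fun t ht => ?_⟩
  have e : z t = Real.exp (-κ * t) • ∫ s in (0 : ℝ)..t, F z s := by
    conv_lhs => rw [← hz, hΦ, max_eq_left ht]
  simp only
  rw [e, smul_smul, ← Real.exp_add, show κ * t + -κ * t = 0 by ring, Real.exp_zero, one_smul]
  congr 1
  refine intervalIntegral.integral_congr_ae (Filter.Eventually.of_forall fun s hs => ?_)
  rw [Set.uIoc_of_le ht] at hs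
  simp only [hF, max_eq_left hs.1.le]

theorem IsRegular.norm_trajectory_sub_le (hP : P.IsRegular Lf Lg Mf Mg)
    (hα : P.IsAdmissible α) (hy : P.IsTrajectory x α y) {t : ℝ} (ht : 0 ≤ t) :
    ‖y t - x‖ ≤ Mf * t := by
  rw [hy.2 t ht, add_sub_cancel_left]
  have h1 := intervalIntegral.norm_integral_le_of_norm_le_const
    (f := fun s => P.f (y s) (α s)) (a := 0) (b := t) (C := Mf) fun s hs =>
      hP.norm_f_le _ _ (hα.2 s (by rw [Set.uIoc_of_le ht] at hs; exact hs.1.le))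
  rwa [sub_zero, abs_of_nonneg ht] at h1

/-- Continuous dependence of trajectories on the initial state. -/
theorem IsRegular.norm_trajectory_sub_trajectory_le (hP : P.IsRegular Lf Lg Mf Mg)
    (hα : P.IsAdmissible α) (hy : P.IsTrajectory x α y) {x' : EuclideanSpace ℝ (Fin d)}
    {y' : ℝ → EuclideanSpace ℝ (Fin d)} (hy' : P.IsTrajectory x' α y') {t : ℝ} (ht : 0 ≤ t) :
    ‖y t - y' t‖ ≤ ‖x - x'‖ * Real.exp (Lf * t) := by
  have hc : Continuous fun s => ‖y (max s 0) - y' (max s 0)‖ :=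
    ((hy.1.comp_continuous (by fun_prop) fun s => Set.mem_Ici.2 (le_max_right _ _)).sub
      (hy'.1.comp_continuous (by fun_prop) fun s => Set.mem_Ici.2 (le_max_right _ _))).norm
  set D : ℝ → ℝ := fun s => ‖y (max s 0) - y' (max s 0)‖ with hD
  -- Gronwall's argument: `D ≤ w` and `w' = Lf D`, so `w e^{-Lf t}` is nonincreasing.
  set w : ℝ → ℝ := fun t => ‖x - x'‖ + Lf * ∫ s in (0 : ℝ)..t, D s with hw
  have hle : ∀ t, 0 ≤ t → D t ≤ w t := by
    intro t ht
    simp only [hD, hw, max_eq_left ht]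
    rw [hy.2 t ht, hy'.2 t ht, add_sub_add_comm, ← intervalIntegral.integral_sub
      (hP.intervalIntegrable_f hα hy.1 le_rfl ht) (hP.intervalIntegrable_f hα hy'.1 le_rfl ht),
      ← intervalIntegral.integral_const_mul]
    refine (norm_add_le _ _).trans (add_le_add le_rfl ?_)
    refine intervalIntegral.norm_integral_le_of_norm_le ht
      (Filter.Eventually.of_forall fun s hs => ?_)
      (Continuous.intervalIntegrable (continuous_const.mul hc) _ _)
    have h := (hP.lipschitz_f _ (hα.2 s hs.1.le)).dist_le_mul (y s) (y' s)
    rw [dist_eq_norm, dist_eq_norm] at h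
    simpa only [hD, max_eq_left hs.1.le] using h
  have hdw : ∀ t, HasDerivAt w (Lf * D t) t := fun t =>
    ((intervalIntegral.integral_hasDerivAt_right (hc.intervalIntegrable _ _)
      hc.stronglyMeasurable.stronglyMeasurableAtFilter hc.continuousAt).const_mul _).const_add _
  have hde : ∀ t, HasDerivAt (fun t => w t * Real.exp (-(Lf * t)))
      (Lf * D t * Real.exp (-(Lf * t)) + w t * (Real.exp (-(Lf * t)) * -(Lf * 1))) t := fun t =>
    (hdw t).mul ((hasDerivAt_id t).const_mul (Lf : ℝ)).neg.exp
  have hanti := antitoneOn_of_hasDerivWithinAt_nonpos (convex_Ici (0 : ℝ))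
    (fun t _ => (hde t).continuousAt.continuousWithinAt)
    (fun t _ => (hde t).hasDerivWithinAt)
    (fun t ht => by
      rw [interior_Ici] at ht
      have h1 := hle t (le_of_lt ht)
      have h2 : 0 ≤ (Lf : ℝ) * Real.exp (-(Lf * t)) := by positivity
      nlinarith)
  have h3 := hanti (Set.mem_Ici.2 le_rfl) (Set.mem_Ici.2 ht) ht
  simp only [hw, intervalIntegral.integral_same, mul_zero, neg_zero, Real.exp_zero, mul_one,
    add_zero] at h3
  rw [Real.exp_neg, ← div_eq_mul_inv, div_le_iff₀ (Real.exp_pos _)] at h3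
  have h4 := hle t ht
  simp only [hD, max_eq_left ht] at h4
  exact h4.trans h3

theorem IsAdmissible.shift (hα : P.IsAdmissible α) {h : ℝ} (hh : 0 ≤ h) :
    P.IsAdmissible fun s => α (s + h) :=
  ⟨hα.1.comp (measurable_id.add_const h), fun _ ht => hα.2 _ (add_nonneg ht hh)⟩

theorem IsRegular.isTrajectory_shift (hP : P.IsRegular Lf Lg Mf Mg) (hα : P.IsAdmissible α)
    (hy : P.IsTrajectory x α y) {h : ℝ} (hh : 0 ≤ h) :
    P.IsTrajectory (y h) (fun s => α (s + h)) fun s => y (s + h) := by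
  refine ⟨hy.1.comp (by fun_prop) fun s hs => add_nonneg hs hh, fun t ht => ?_⟩
  have hth := add_nonneg ht hh
  change y (t + h) = _
  rw [intervalIntegral.integral_comp_add_right (fun s => P.f (y s) (α s)), zero_add, hy.2 _ hth,
    hy.2 h hh, add_assoc, intervalIntegral.integral_add_adjacent_intervals
      (hP.intervalIntegrable_f hα hy.1 le_rfl hh) (hP.intervalIntegrable_f hα hy.1 hh hth)]

theorem cost_congr {α' : ℝ → EuclideanSpace ℝ (Fin m)} {y' : ℝ → EuclideanSpace ℝ (Fin d)}
    (hα : ∀ s, 0 < s → α s = α' s) (hy : ∀ s, 0 < s → y s = y' s) :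
    P.cost α y = P.cost α' y' :=
  setIntegral_congr_fun measurableSet_Ioi fun s hs => by
    simp only [hα s hs, hy s hs]

/-- Splitting the cost at the time `h`. -/
theorem IsRegular.cost_eq (hP : P.IsRegular Lf Lg Mf Mg) (hα : P.IsAdmissible α)
    (hy : ContinuousOn y (Set.Ici 0)) {h : ℝ} (hh : 0 ≤ h) :
    P.cost α y = (∫ s in (0 : ℝ)..h, P.g (y s) (α s) * Real.exp (-P.lam * s)) +
      Real.exp (-P.lam * h) * P.cost (fun s => α (s + h)) fun s => y (s + h) := by
  have hi := hP.integrableOn_cost hα hy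
  rw [cost, ← intervalIntegral.integral_interval_add_Ioi hi
    (hi.mono_set (Set.Ioi_subset_Ioi hh)), cost, ← integral_const_mul]
  congr 1
  have := (measurePreserving_add_right volume h).setIntegral_preimage_emb
    (measurableEmbedding_addRight h)
    (fun s => P.g (y s) (α s) * Real.exp (-P.lam * s)) (Set.Ioi h)
  rw [← this, Set.preimage_add_const_Ioi, sub_self]
  refine setIntegral_congr_fun measurableSet_Ioi fun s _ => ?_
  rw [mul_add, Real.exp_add]
  ring

/-- Concatenation of controlled trajectories. -/
theorem IsRegular.exists_concat (hP : P.IsRegular Lf Lg Mf Mg) (hα : P.IsAdmissible α)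
    (hy : P.IsTrajectory x α y) {h : ℝ} (hh : 0 ≤ h) {β : ℝ → EuclideanSpace ℝ (Fin m)}
    {z : ℝ → EuclideanSpace ℝ (Fin d)} (hβ : P.IsAdmissible β)
    (hz : P.IsTrajectory (y h) β z) :
    ∃ α' y', P.IsAdmissible α' ∧ P.IsTrajectory x α' y' ∧
      P.cost α' y' = (∫ s in (0 : ℝ)..h, P.g (y s) (α s) * Real.exp (-P.lam * s)) +
        Real.exp (-P.lam * h) * P.cost β z := by
  set α' : ℝ → EuclideanSpace ℝ (Fin m) := fun t => if t ≤ h then α t else β (t - h) with hα'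
  set y' : ℝ → EuclideanSpace ℝ (Fin d) := fun t => if t ≤ h then y t else z (t - h) with hy'
  have hz0 : z 0 = y h := by simpa using hz.2 0 le_rfl
  have ha : P.IsAdmissible α' := by
    refine ⟨Measurable.ite measurableSet_Iic hα.1 (hβ.1.comp (measurable_id.sub_const h)),
      fun t ht => ?_⟩
    by_cases hth : t ≤ h
    · simp only [hα', if_pos hth]; exact hα.2 t ht
    · simp only [hα', if_neg hth]; exact hβ.2 _ (by linarith)
  have hyc : ContinuousOn y' (Set.Ici 0) := by
    have h1 : Continuous fun s => y (max s 0) :=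
      hy.1.comp_continuous (by fun_prop) fun s => Set.mem_Ici.2 (le_max_right _ _)
    have h2 : Continuous fun s => z (max (s - h) 0) :=
      hz.1.comp_continuous (by fun_prop) fun s => Set.mem_Ici.2 (le_max_right _ _)
    have h3 : Continuous fun s => if s ≤ h then y (max s 0) else z (max (s - h) 0) :=
      h1.if_le h2 continuous_id continuous_const fun s hs => by
        rw [hs, sub_self, max_self, max_eq_left hh, hz0]
    refine h3.continuousOn.congr fun s hs => ?_
    by_cases hsh : s ≤ h
    · simp only [hy', if_pos hsh, max_eq_left (Set.mem_Ici.1 hs)]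
    · simp only [hy', if_neg hsh, max_eq_left (by linarith : 0 ≤ s - h)]
  have hI1 : ∀ t, 0 ≤ t → t ≤ h → ∫ s in (0 : ℝ)..t, P.f (y' s) (α' s) =
      ∫ s in (0 : ℝ)..t, P.f (y s) (α s) := fun t ht hth =>
    intervalIntegral.integral_congr_ae (Filter.Eventually.of_forall fun s hs => by
      rw [Set.uIoc_of_le ht] at hs
      simp only [hy', hα', if_pos (hs.2.trans hth)])
  have htr : P.IsTrajectory x α' y' := by
    refine ⟨hyc, fun t ht => ?_⟩
    by_cases hth : t ≤ h
    · rw [hI1 t ht hth, ← hy.2 t ht]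
      simp only [hy', if_pos hth]
    · have hht : h ≤ t := le_of_not_ge hth
      rw [← intervalIntegral.integral_add_adjacent_intervals
        (hP.intervalIntegrable_f ha hyc le_rfl hh) (hP.intervalIntegrable_f ha hyc hh ht),
        hI1 h hh le_rfl, ← add_assoc, ← hy.2 h hh]
      have e : ∫ s in h..t, P.f (y' s) (α' s) =
          ∫ s in h..t, P.f (z (s - h)) (β (s - h)) :=
        intervalIntegral.integral_congr_ae (Filter.Eventually.of_forall fun s hs => by
          rw [Set.uIoc_of_le hht] at hs
          simp only [hy', hα', if_neg (not_le.2 hs.1)])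
      rw [e, intervalIntegral.integral_comp_sub_right (fun s => P.f (z s) (β s)), sub_self,
        ← hz.2 _ (by linarith)]
      simp only [hy', if_neg hth]
  refine ⟨α', y', ha, htr, ?_⟩
  rw [hP.cost_eq ha hyc hh]
  congr 1
  · exact intervalIntegral.integral_congr_ae (Filter.Eventually.of_forall fun s hs => by
      rw [Set.uIoc_of_le hh] at hs
      simp only [hy', hα', if_pos hs.2])
  · congr 1
    refine cost_congr (fun s hs => ?_) (fun s hs => ?_)
    · simp only [hα', if_neg (by linarith : ¬ s + h ≤ h), add_sub_cancel_right]
    · simp only [hy', if_neg (by linarith : ¬ s + h ≤ h), add_sub_cancel_right]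

theorem IsRegular.abs_cost_le (hP : P.IsRegular Lf Lg Mf Mg) (hα : P.IsAdmissible α) :
    |P.cost α y| ≤ Mg / P.lam := by
  have h1 : ∫ s in Set.Ioi (0 : ℝ), Mg * Real.exp (-P.lam * s) = Mg / P.lam := by
    rw [integral_const_mul, integral_exp_mul_Ioi (by linarith [hP.lam_pos])]
    simp [div_eq_mul_inv]
  rw [← h1, ← Real.norm_eq_abs]
  refine norm_integral_le_of_norm_le ((exp_neg_integrableOn_Ioi 0 hP.lam_pos).const_mul Mg) ?_
  filter_upwards [ae_restrict_mem measurableSet_Ioi] with s hs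
  rw [norm_mul, Real.norm_of_nonneg (Real.exp_pos _).le]
  exact mul_le_mul_of_nonneg_right (hP.abs_g_le _ _ (hα.2 s (le_of_lt hs))) (Real.exp_pos _).le

/-! ### The value function and dynamic programming -/

theorem IsRegular.exists_isAdmissible (hP : P.IsRegular Lf Lg Mf Mg) :
    ∃ α, P.IsAdmissible α := by
  obtain ⟨a, ha⟩ := hP.nonempty
  exact ⟨fun _ => a, measurable_const, fun _ _ => ha⟩

theorem IsRegular.bddBelow_costs (hP : P.IsRegular Lf Lg Mf Mg)
    (x : EuclideanSpace ℝ (Fin d)) :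
    BddBelow {J | ∃ α y, P.IsAdmissible α ∧ P.IsTrajectory x α y ∧ J = P.cost α y} :=
  ⟨-(Mg / P.lam), by
    rintro _ ⟨α, y, hα, -, rfl⟩
    exact (abs_le.1 (hP.abs_cost_le hα)).1⟩

theorem IsRegular.costs_nonempty (hP : P.IsRegular Lf Lg Mf Mg)
    (x : EuclideanSpace ℝ (Fin d)) :
    {J | ∃ α y, P.IsAdmissible α ∧ P.IsTrajectory x α y ∧ J = P.cost α y}.Nonempty := by
  obtain ⟨α, hα⟩ := hP.exists_isAdmissible
  obtain ⟨y, hy⟩ := hP.exists_isTrajectory hα x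
  exact ⟨_, α, y, hα, hy, rfl⟩

theorem IsRegular.value_le_cost (hP : P.IsRegular Lf Lg Mf Mg) (hα : P.IsAdmissible α)
    (hy : P.IsTrajectory x α y) : P.value x ≤ P.cost α y :=
  csInf_le (hP.bddBelow_costs x) ⟨α, y, hα, hy, rfl⟩

theorem IsRegular.exists_cost_lt (hP : P.IsRegular Lf Lg Mf Mg)
    (x : EuclideanSpace ℝ (Fin d)) {ε : ℝ} (hε : 0 < ε) :
    ∃ α y, P.IsAdmissible α ∧ P.IsTrajectory x α y ∧ P.cost α y < P.value x + ε := by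
  obtain ⟨_, ⟨α, y, hα, hy, rfl⟩, h⟩ :=
    exists_lt_of_csInf_lt (hP.costs_nonempty x) (lt_add_of_pos_right (P.value x) hε)
  exact ⟨α, y, hα, hy, h⟩

theorem IsRegular.abs_value_le (hP : P.IsRegular Lf Lg Mf Mg)
    (x : EuclideanSpace ℝ (Fin d)) : |P.value x| ≤ Mg / P.lam := by
  obtain ⟨α, hα⟩ := hP.exists_isAdmissible
  obtain ⟨y, hy⟩ := hP.exists_isTrajectory hα x
  refine abs_le.2 ⟨le_csInf (hP.costs_nonempty x) ?_,
    (hP.value_le_cost hα hy).trans (abs_le.1 (hP.abs_cost_le hα)).2⟩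
  rintro _ ⟨α, y, hα, -, rfl⟩
  exact (abs_le.1 (hP.abs_cost_le hα)).1

/-- Use a nearly optimal control for `x'` from `x` as well: trajectories separate at most like
`e^{Lf s}`, which the discount beats because `λ > Lf`. This gives the constant `Lg / (λ - Lf)`. -/
theorem IsRegular.exists_lipschitzWith_value (hP : P.IsRegular Lf Lg Mf Mg) :
    ∃ K : ℝ≥0, LipschitzWith K P.value := by
  have hpos : 0 < P.lam - Lf := sub_pos.2 hP.lt_lam
  refine ⟨⟨Lg / (P.lam - Lf), by positivity⟩, LipschitzWith.of_le_add_mul _ fun x x' => ?_⟩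
  refine le_of_forall_pos_le_add fun ε hε => ?_
  obtain ⟨α, y', hα, hy', hlt⟩ := hP.exists_cost_lt x' hε
  obtain ⟨y, hy⟩ := hP.exists_isTrajectory hα x
  have h1 := hP.value_le_cost hα hy
  have h2 : P.cost α y - P.cost α y' ≤ Lg / (P.lam - Lf) * dist x x' := by
    rw [cost, cost, ← integral_sub (hP.integrableOn_cost hα hy.1) (hP.integrableOn_cost hα hy'.1)]
    have h3 : ∫ s in Set.Ioi (0 : ℝ), Lg * ‖x - x'‖ * Real.exp (-(P.lam - Lf) * s) =
        Lg / (P.lam - Lf) * dist x x' := by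
      rw [integral_const_mul, integral_exp_mul_Ioi (by linarith), dist_eq_norm]
      simp only [mul_zero, Real.exp_zero, neg_div_neg_eq]
      ring
    rw [← h3]
    refine (le_abs_self _).trans ?_
    rw [← Real.norm_eq_abs]
    refine norm_integral_le_of_norm_le
      ((exp_neg_integrableOn_Ioi 0 hpos).const_mul (Lg * ‖x - x'‖)) ?_
    filter_upwards [ae_restrict_mem measurableSet_Ioi] with s hs
    have h4 := (hP.lipschitz_g _ (hα.2 s (le_of_lt hs))).dist_le_mul (y s) (y' s)
    have h5 := hP.norm_trajectory_sub_trajectory_le hα hy hy' (le_of_lt hs)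
    rw [dist_eq_norm, dist_eq_norm] at h4
    rw [← sub_mul, norm_mul, Real.norm_of_nonneg (Real.exp_pos _).le]
    calc _ ≤ Lg * (‖x - x'‖ * Real.exp (Lf * s)) * Real.exp (-P.lam * s) := by
          refine mul_le_mul_of_nonneg_right (h4.trans ?_) (Real.exp_pos _).le
          exact mul_le_mul_of_nonneg_left h5 Lg.2
      _ = Lg * ‖x - x'‖ * (Real.exp (Lf * s) * Real.exp (-P.lam * s)) := by ring
      _ = _ := by rw [← Real.exp_add]; ring_nf
  change P.value x ≤ P.value x' + Lg / (P.lam - Lf) * dist x x' + ε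
  linarith

/-- Dynamic programming: the lower bound along any trajectory. -/
theorem IsRegular.dynamic_programming_le_cost (hP : P.IsRegular Lf Lg Mf Mg)
    (hα : P.IsAdmissible α) (hy : P.IsTrajectory x α y) {h : ℝ} (hh : 0 ≤ h) :
    (∫ s in (0 : ℝ)..h, P.g (y s) (α s) * Real.exp (-P.lam * s)) +
      Real.exp (-P.lam * h) * P.value (y h) ≤ P.cost α y := by
  rw [hP.cost_eq hα hy.1 hh]
  have := hP.value_le_cost (hα.shift hh) (hP.isTrajectory_shift hα hy hh)
  gcongr

/-- Dynamic programming: suboptimality of any control on `[0, h]`. -/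
theorem IsRegular.value_le_dynamic_programming (hP : P.IsRegular Lf Lg Mf Mg)
    (hα : P.IsAdmissible α) (hy : P.IsTrajectory x α y) {h : ℝ} (hh : 0 ≤ h) :
    P.value x ≤ (∫ s in (0 : ℝ)..h, P.g (y s) (α s) * Real.exp (-P.lam * s)) +
      Real.exp (-P.lam * h) * P.value (y h) := by
  refine le_of_forall_pos_le_add fun ε hε => ?_
  obtain ⟨β, z, hβ, hz, hlt⟩ := hP.exists_cost_lt (y h) hε
  obtain ⟨α', y', hα', hy', e⟩ := hP.exists_concat hα hy hh hβ hz
  have h1 := hP.value_le_cost hα' hy'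
  have h2 : Real.exp (-P.lam * h) ≤ 1 := by
    rw [Real.exp_le_one_iff]
    have := mul_nonneg hP.lam_pos.le hh
    linarith
  have h3 := mul_le_mul_of_nonneg_left hlt.le (Real.exp_pos (-P.lam * h)).le
  rw [e] at h1
  nlinarith

end ControlProblem

/-! ### Hamilton-Jacobi-Bellman inequalities against quadratic test functions -/

theorem nonpos_of_forall_le_mul {r C h₀ : ℝ} (h₀pos : 0 < h₀)
    (H : ∀ h, 0 < h → h ≤ h₀ → r ≤ C * h) : r ≤ 0 := by
  have h1 : Filter.Tendsto (fun h : ℝ => C * h) (nhdsWithin 0 (Set.Ioi 0)) (nhds 0) := by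
    have : Filter.Tendsto (fun h : ℝ => C * h) (nhds 0) (nhds (C * 0)) :=
      (continuous_const.mul continuous_id).tendsto 0
    rw [mul_zero] at this
    exact this.mono_left nhdsWithin_le_nhds
  refine ge_of_tendsto h1 ?_
  filter_upwards [Ioc_mem_nhdsGT h₀pos] with h hh
  exact H h hh.1 hh.2

theorem abs_exp_neg_sub_one_le {z : ℝ} (hz : 0 ≤ z) : |Real.exp (-z) - 1| ≤ z := by
  have h1 : Real.exp (-z) ≤ 1 := Real.exp_le_one_iff.2 (by linarith)
  rw [abs_of_nonpos (by linarith)]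
  linarith [Real.add_one_le_exp (-z)]

theorem abs_exp_neg_sub_one_add_le {z : ℝ} (hz : 0 ≤ z) (hz1 : z ≤ 1) :
    |Real.exp (-z) - 1 + z| ≤ z ^ 2 := by
  have := Real.abs_exp_sub_one_sub_id_le (x := -z) (by rwa [abs_neg, abs_of_nonneg hz])
  rwa [sub_neg_eq_add, neg_sq] at this

namespace ControlProblem

open MeasureTheory

variable {d m : ℕ} {P : ControlProblem d m} {Lf Lg : ℝ≥0} {Mf Mg : ℝ}

/-- The Hamiltonian integrand at `x` with momentum `p`. -/
noncomputable def ham (P : ControlProblem d m) (x p : EuclideanSpace ℝ (Fin d))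
    (a : EuclideanSpace ℝ (Fin m)) : ℝ :=
  P.g x a + inner ℝ p (P.f x a)

theorem IsRegular.abs_inner_f_sub_le (hP : P.IsRegular Lf Lg Mf Mg)
    {a : EuclideanSpace ℝ (Fin m)} (ha : a ∈ P.A) (p x y : EuclideanSpace ℝ (Fin d)) :
    |inner ℝ p (P.f x a) - inner ℝ p (P.f y a)| ≤ ‖p‖ * (Lf * ‖x - y‖) := by
  rw [← inner_sub_right]
  refine (abs_real_inner_le_norm _ _).trans (mul_le_mul_of_nonneg_left ?_ (norm_nonneg _))
  have := (hP.lipschitz_f a ha).dist_le_mul x y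
  rwa [dist_eq_norm, dist_eq_norm] at this

theorem IsRegular.abs_g_sub_le (hP : P.IsRegular Lf Lg Mf Mg)
    {a : EuclideanSpace ℝ (Fin m)} (ha : a ∈ P.A) (x y : EuclideanSpace ℝ (Fin d)) :
    |P.g x a - P.g y a| ≤ Lg * ‖x - y‖ := by
  have := (hP.lipschitz_g a ha).dist_le_mul x y
  rwa [Real.dist_eq, dist_eq_norm] at this

theorem IsRegular.intervalIntegrable_ham (hP : P.IsRegular Lf Lg Mf Mg)
    {α : ℝ → EuclideanSpace ℝ (Fin m)} {y : ℝ → EuclideanSpace ℝ (Fin d)}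
    (hα : P.IsAdmissible α) (hy : ContinuousOn y (Set.Ici 0)) (p : EuclideanSpace ℝ (Fin d))
    {a b : ℝ} (ha : 0 ≤ a) (hb : 0 ≤ b) :
    IntervalIntegrable (fun s => P.ham (y s) p (α s)) volume a b := by
  have h := hP.intervalIntegrable_f hα hy ha hb
  exact (hP.intervalIntegrable_g hα hy ha hb).add
    ⟨h.1.const_inner p, h.2.const_inner p⟩

/-- Second order expansion of the dynamic programming functional along trajectories, for a
quadratic terminal function. -/
theorem IsRegular.exists_expansion (hP : P.IsRegular Lf Lg Mf Mg)
    (x₀ y₀ : EuclideanSpace ℝ (Fin d)) (κ v₀ : ℝ) :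
    ∃ K : ℝ, ∀ (α : ℝ → EuclideanSpace ℝ (Fin m)) (y : ℝ → EuclideanSpace ℝ (Fin d)) (h : ℝ),
      P.IsAdmissible α → P.IsTrajectory y₀ α y → 0 < h → h ≤ 1 → P.lam * h ≤ 1 →
      |(∫ s in (0 : ℝ)..h, P.g (y s) (α s) * Real.exp (-P.lam * s)) +
        Real.exp (-P.lam * h) * (v₀ + κ * (‖y h - x₀‖ ^ 2 - ‖y₀ - x₀‖ ^ 2)) - v₀ +
        P.lam * h * v₀ - ∫ s in (0 : ℝ)..h, P.ham y₀ ((2 * κ) • (y₀ - x₀)) (α s)| ≤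
      K * h ^ 2 := by
  set p := (2 * κ) • (y₀ - x₀) with hp
  have hMf := hP.Mf_nonneg
  have hMg := hP.Mg_nonneg
  have hlam := hP.lam_pos
  -- In order: freezing the state and the discount in the integrand, the squared displacement,
  -- discounting of the terminal increment, second order of `e^{-λh} v₀`. The constant is uniform in
  -- the control, which the supersolution property needs.
  refine ⟨(Lg * Mf + Mg * P.lam + ‖p‖ * (Lf * Mf)) + |κ| * Mf ^ 2 +
    P.lam * (‖p‖ * Mf + |κ| * Mf ^ 2) + P.lam ^ 2 * |v₀|, fun α y h hα hy hh hh1 hlh => ?_⟩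
  have hgi : IntervalIntegrable (fun s => P.g (y s) (α s) * Real.exp (-P.lam * s)) volume 0 h :=
    (intervalIntegrable_iff_integrableOn_Ioc_of_le hh.le).2
      ((hP.integrableOn_cost hα hy.1).mono_set Set.Ioc_subset_Ioi_self)
  have hfi := hP.intervalIntegrable_f hα hy.1 le_rfl hh.le
  have hfpi : IntervalIntegrable (fun s => (inner ℝ p (P.f (y s) (α s)) : ℝ)) volume 0 h :=
    ⟨hfi.1.const_inner p, hfi.2.const_inner p⟩
  have hhi := hP.intervalIntegrable_ham hα (y := fun _ => y₀) continuousOn_const p le_rfl hh.le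
  set z := ∫ s in (0 : ℝ)..h, P.f (y s) (α s) with hz
  have hyz : y h = y₀ + z := hy.2 h hh.le
  have hznorm : ‖z‖ ≤ Mf * h := by
    have := hP.norm_trajectory_sub_le hα hy hh.le
    rwa [hyz, add_sub_cancel_left] at this
  have hpz : (inner ℝ p z : ℝ) = ∫ s in (0 : ℝ)..h, (inner ℝ p (P.f (y s) (α s)) : ℝ) := by
    rw [hz, intervalIntegral.integral_of_le hh.le, intervalIntegral.integral_of_le hh.le,
      integral_inner hfi.1]
  -- For a quadratic the Taylor expansion is exact.
  have hD : κ * (‖y h - x₀‖ ^ 2 - ‖y₀ - x₀‖ ^ 2) = inner ℝ p z + κ * ‖z‖ ^ 2 := by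
    rw [hyz, show y₀ + z - x₀ = (y₀ - x₀) + z by abel, norm_add_sq_real, hp, inner_smul_left]
    simp only [conj_trivial]
    ring
  have h1 : |(∫ s in (0 : ℝ)..h, P.g (y s) (α s) * Real.exp (-P.lam * s)) + inner ℝ p z -
      ∫ s in (0 : ℝ)..h, P.ham y₀ p (α s)| ≤
      (Lg * Mf + Mg * P.lam + ‖p‖ * (Lf * Mf)) * h * h := by
    rw [hpz, ← intervalIntegral.integral_add hgi hfpi,
      ← intervalIntegral.integral_sub (hgi.add hfpi) hhi, ← Real.norm_eq_abs]
    have := intervalIntegral.norm_integral_le_of_norm_le_const (a := 0) (b := h)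
      (f := fun s => P.g (y s) (α s) * Real.exp (-P.lam * s) + inner ℝ p (P.f (y s) (α s)) -
        P.ham y₀ p (α s)) (C := (Lg * Mf + Mg * P.lam + ‖p‖ * (Lf * Mf)) * h) fun s hs => by
      rw [Set.uIoc_of_le hh.le] at hs
      have ha := hα.2 s hs.1.le
      have e1 := hP.norm_trajectory_sub_le hα hy hs.1.le
      have e1' : ‖y s - y₀‖ ≤ Mf * h := e1.trans (mul_le_mul_of_nonneg_left hs.2 hMf)
      have e2 : |P.g (y s) (α s) - P.g y₀ (α s)| ≤ Lg * (Mf * h) :=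
        (hP.abs_g_sub_le ha _ _).trans (mul_le_mul_of_nonneg_left e1' Lg.2)
      have e3 : |inner ℝ p (P.f (y s) (α s)) - inner ℝ p (P.f y₀ (α s))| ≤
          ‖p‖ * (Lf * (Mf * h)) := (hP.abs_inner_f_sub_le ha _ _ _).trans (by gcongr)
      have e4 : |P.g (y s) (α s) * (Real.exp (-(P.lam * s)) - 1)| ≤ Mg * (P.lam * h) := by
        rw [abs_mul]
        refine mul_le_mul (hP.abs_g_le _ _ ha) ((abs_exp_neg_sub_one_le
          (mul_nonneg hlam.le hs.1.le)).trans ?_) (abs_nonneg _) hMg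
        exact mul_le_mul_of_nonneg_left hs.2 hlam.le
      rw [Real.norm_eq_abs, ham, neg_mul]
      have e : P.g (y s) (α s) * Real.exp (-(P.lam * s)) + inner ℝ p (P.f (y s) (α s)) -
          (P.g y₀ (α s) + inner ℝ p (P.f y₀ (α s))) =
          (P.g (y s) (α s) - P.g y₀ (α s)) +
          P.g (y s) (α s) * (Real.exp (-(P.lam * s)) - 1) +
          (inner ℝ p (P.f (y s) (α s)) - inner ℝ p (P.f y₀ (α s))) := by ring
      rw [e]
      refine (abs_add_three _ _ _).trans ?_
      linarith
    rwa [sub_zero, abs_of_pos hh] at this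
  have h2 : |κ * ‖z‖ ^ 2| ≤ |κ| * Mf ^ 2 * h ^ 2 := by
    rw [abs_mul, abs_of_nonneg (sq_nonneg ‖z‖), mul_assoc, ← mul_pow]
    gcongr
  have h3 : |inner ℝ p z + κ * ‖z‖ ^ 2| ≤ (‖p‖ * Mf + |κ| * Mf ^ 2) * h := by
    have e1 : |(inner ℝ p z : ℝ)| ≤ ‖p‖ * (Mf * h) :=
      (abs_real_inner_le_norm _ _).trans (by gcongr)
    have e2 : |κ| * Mf ^ 2 * h ^ 2 ≤ |κ| * Mf ^ 2 * h := by
      gcongr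
      nlinarith
    refine (abs_add_le _ _).trans ?_
    linarith
  have hlh0 : 0 ≤ P.lam * h := mul_nonneg hlam.le hh.le
  have h4 : |(Real.exp (-(P.lam * h)) - 1) * (inner ℝ p z + κ * ‖z‖ ^ 2)| ≤
      P.lam * h * ((‖p‖ * Mf + |κ| * Mf ^ 2) * h) := by
    rw [abs_mul]
    exact mul_le_mul (abs_exp_neg_sub_one_le hlh0) h3 (abs_nonneg _) hlh0
  have h5 : |(Real.exp (-(P.lam * h)) - 1 + P.lam * h) * v₀| ≤ (P.lam * h) ^ 2 * |v₀| := by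
    rw [abs_mul]
    exact mul_le_mul_of_nonneg_right (abs_exp_neg_sub_one_add_le hlh0 hlh) (abs_nonneg _)
  rw [hD]
  simp only [neg_mul] at h1 ⊢
  rw [abs_le] at *
  constructor <;> linarith [h1.1, h1.2, h2.1, h2.2, h4.1, h4.2, h5.1, h5.2]

/-- The value function is a supersolution of the Hamilton-Jacobi-Bellman equation, tested with
quadratic functions. -/
theorem IsRegular.value_supersolution (hP : P.IsRegular Lf Lg Mf Mg)
    {x₀ y₀ : EuclideanSpace ℝ (Fin d)} {κ c : ℝ}
    (hv : ∀ y, P.value y₀ + κ * (‖y - x₀‖ ^ 2 - ‖y₀ - x₀‖ ^ 2) ≤ P.value y)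
    (hc : ∀ a ∈ P.A, c ≤ P.ham y₀ ((2 * κ) • (y₀ - x₀)) a) : c ≤ P.lam * P.value y₀ := by
  obtain ⟨K, hK⟩ := hP.exists_expansion x₀ y₀ κ (P.value y₀)
  have hlam := hP.lam_pos
  refine sub_nonpos.1 (nonpos_of_forall_le_mul (C := K + 1) (h₀ := min 1 (1 / P.lam))
    (by positivity) fun h hh hh' => ?_)
  have hlh : P.lam * h ≤ 1 := by
    have := hh'.trans (min_le_right _ _)
    rwa [le_div_iff₀ hlam, mul_comm] at this
  -- An `h²`-optimal control replaces an optimal one: its defect still vanishes after division by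
  -- `h`.
  obtain ⟨α, y, hα, hy, hlt⟩ := hP.exists_cost_lt y₀ (pow_pos hh 2)
  have h1 := hP.dynamic_programming_le_cost hα hy hh.le
  have h2 := mul_le_mul_of_nonneg_left (hv (y h)) (Real.exp_pos (-P.lam * h)).le
  have h3 := (abs_le.1 (hK α y h hα hy hh (hh'.trans (min_le_left _ _)) hlh)).1
  have h4 : c * h ≤ ∫ s in (0 : ℝ)..h, P.ham y₀ ((2 * κ) • (y₀ - x₀)) (α s) := by
    have := intervalIntegral.integral_mono_on (f := fun _ => c) hh.le
      intervalIntegrable_const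
      (hP.intervalIntegrable_ham hα (y := fun _ => y₀) continuousOn_const
        ((2 * κ) • (y₀ - x₀)) le_rfl hh.le) fun s hs => hc _ (hα.2 s hs.1)
    rwa [intervalIntegral.integral_const, sub_zero, smul_eq_mul, mul_comm] at this
  have h5 : (c - P.lam * P.value y₀) * h ≤ (K + 1) * h * h := by nlinarith
  exact le_of_mul_le_mul_right h5 hh

/-- The value function is a subsolution of the Hamilton-Jacobi-Bellman equation, tested with
quadratic functions. -/
theorem IsRegular.value_subsolution (hP : P.IsRegular Lf Lg Mf Mg)
    {x₀ y₀ : EuclideanSpace ℝ (Fin d)} {κ : ℝ}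
    (hv : ∀ y, P.value y ≤ P.value y₀ + κ * (‖y - x₀‖ ^ 2 - ‖y₀ - x₀‖ ^ 2))
    {a : EuclideanSpace ℝ (Fin m)} (ha : a ∈ P.A) :
    P.lam * P.value y₀ ≤ P.ham y₀ ((2 * κ) • (y₀ - x₀)) a := by
  obtain ⟨K, hK⟩ := hP.exists_expansion x₀ y₀ κ (P.value y₀)
  have hlam := hP.lam_pos
  -- Constant controls suffice to test the subsolution inequality.
  have hα : P.IsAdmissible fun _ => a := ⟨measurable_const, fun _ _ => ha⟩
  obtain ⟨y, hy⟩ := hP.exists_isTrajectory hα y₀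
  refine sub_nonpos.1 (nonpos_of_forall_le_mul (C := K) (h₀ := min 1 (1 / P.lam))
    (by positivity) fun h hh hh' => ?_)
  have hlh : P.lam * h ≤ 1 := by
    have := hh'.trans (min_le_right _ _)
    rwa [le_div_iff₀ hlam, mul_comm] at this
  have h1 := hP.value_le_dynamic_programming hα hy hh.le
  have h2 := mul_le_mul_of_nonneg_left (hv (y h)) (Real.exp_pos (-P.lam * h)).le
  have h3 := (abs_le.1 (hK _ y h hα hy hh (hh'.trans (min_le_left _ _)) hlh)).2
  rw [intervalIntegral.integral_const, sub_zero, smul_eq_mul] at h3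
  have h5 : (P.lam * P.value y₀ - P.ham y₀ ((2 * κ) • (y₀ - x₀)) a) * h ≤ K * h * h := by
    nlinarith
  exact le_of_mul_le_mul_right h5 hh

end ControlProblem

/-! ### Doubling of variables and the a priori error estimate -/

/-- Attainment of the maximum in the doubling of variables. -/
theorem exists_forall_penalized_le {E ι : Type*} [NormedAddCommGroup E] [ProperSpace E]
    [Finite ι] [Nonempty ι] (x : ι → E) (c : ι → ℝ) {φ : E → ℝ} (hφ : Continuous φ) {B κ : ℝ}
    (hB : ∀ y, |φ y| ≤ B) (hκ : 0 < κ) :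
    ∃ i₀ y₀, ∀ i y, c i + φ y - κ * ‖x i - y‖ ^ 2 ≤ c i₀ + φ y₀ - κ * ‖x i₀ - y₀‖ ^ 2 := by
  have h1 : ∀ i, ∃ z, ∀ y, c i + φ y - κ * ‖x i - y‖ ^ 2 ≤ c i + φ z - κ * ‖x i - z‖ ^ 2 := by
    intro i
    refine Continuous.exists_forall_ge' (f := fun y => c i + φ y - κ * ‖x i - y‖ ^ 2)
      (by fun_prop) (x i) ?_
    have h2 : Filter.Tendsto (fun y => κ * ‖x i - y‖ ^ 2) (Filter.cocompact E) Filter.atTop := by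
      refine Filter.Tendsto.const_mul_atTop hκ
        ((Filter.tendsto_pow_atTop two_ne_zero).comp ?_)
      exact (tendsto_dist_left_cocompact_atTop (x i)).congr fun y => dist_eq_norm _ _
    -- Once the penalty exceeds the oscillation bound `2 * B`, the functional is below its value at
    -- `x i`.
    filter_upwards [h2.eventually_ge_atTop (2 * B)] with y hy
    have h3 := abs_le.1 (hB y)
    have h4 := abs_le.1 (hB (x i))
    simp only [sub_self, norm_zero]
    nlinarith [h3.2, h4.1]
  choose z hz using h1
  obtain ⟨i₀, hi₀⟩ := Finite.exists_max fun i => c i + φ (z i) - κ * ‖x i - z i‖ ^ 2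
  exact ⟨i₀, z i₀, fun i y => (hz i y).trans (hi₀ i)⟩

namespace ControlProblem

variable {d m : ℕ} {l u : Fin d → ℝ} {P : ControlProblem d m} {Lf Lg : ℝ≥0} {Mf Mg : ℝ}
  {G : Grid l u} {t : ℝ} {V : G.Node → ℝ}

/-- This takes the place of a consistency estimate for the interpolation: it uses positivity and
second moments of the weights, and no smoothness of `V`. -/
theorem interp_le_of_quadratic (G : Grid l u) {V : G.Node → ℝ}
    {z y₀ : EuclideanSpace ℝ (Fin d)} (hz : z ∈ box l u) {c κ : ℝ} (hκ : 0 ≤ κ)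
    (hV : ∀ j, V j ≤ c + κ * ‖G.point j - y₀‖ ^ 2) :
    G.interp V z ≤ c + κ * (‖z - y₀‖ ^ 2 + d * G.dx ^ 2) := by
  have h1 := G.sum_weight_mul_norm_sq_le hz y₀
  refine (G.interp_mono hV z).trans ?_
  have e : G.interp (fun j => c + κ * ‖G.point j - y₀‖ ^ 2) z =
      c * ∑ j, G.weight z j + κ * ∑ j, G.weight z j * ‖G.point j - y₀‖ ^ 2 := by
    rw [Grid.interp_eq, Finset.mul_sum, Finset.mul_sum, ← Finset.sum_add_distrib]
    exact Finset.sum_congr rfl fun j _ => by ring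
  rw [e, G.sum_weight hz, mul_one]
  gcongr

theorem IsRegular.norm_step_sub_sq_le (hP : P.IsRegular Lf Lg Mf Mg)
    (x y : EuclideanSpace ℝ (Fin d)) {a : EuclideanSpace ℝ (Fin m)} (ha : a ∈ P.A) (t : ℝ) :
    ‖x + t • P.f x a - y‖ ^ 2 ≤
      ‖x - y‖ ^ 2 + 2 * t * inner ℝ (x - y) (P.f x a) + t ^ 2 * Mf ^ 2 := by
  rw [show x + t • P.f x a - y = (x - y) + t • P.f x a by abel, norm_add_sq_real,
    inner_smul_right, norm_smul, mul_pow, Real.norm_eq_abs, sq_abs]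
  have : ‖P.f x a‖ ^ 2 ≤ Mf ^ 2 := by
    gcongr
    exact hP.norm_f_le _ _ ha
  have := mul_le_mul_of_nonneg_left this (sq_nonneg t)
  linarith

/-- `λt - (1 - γ)` is of order `t²`, while `λt ≤ 1/2` gives `1 - γ ≥ λt/2` and hence `λ |V i| ≤ 2
Mg`. -/
theorem IsRegular.abs_discount_error_le (hP : P.IsRegular Lf Lg Mf Mg) (ht : 0 < t)
    (htl : P.lam * t ≤ 1 / 2) (hI : P.Invariant G t)
    (hV : Function.IsFixedPt (P.bellman G t) V) (i : G.Node) :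
    |P.lam * t * V i - (1 - P.discount t) * V i| ≤ 2 * P.lam * Mg * t * t := by
  have hlam := hP.lam_pos
  have h0 : 0 < P.lam * t := mul_pos hlam ht
  have h1 := abs_exp_neg_sub_one_add_le h0.le (by linarith)
  rw [← neg_mul] at h1
  change |P.discount t - 1 + P.lam * t| ≤ _ at h1
  have h2 := hP.abs_fixedPt_le ht hI hV i
  have h3 : P.lam * t / 2 ≤ 1 - P.discount t := by
    have := (abs_le.1 h1).2
    nlinarith
  have h4 : P.lam * |V i| ≤ 2 * Mg := by
    have : P.lam * t / 2 * |V i| ≤ t * Mg :=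
      (mul_le_mul_of_nonneg_right h3 (abs_nonneg _)).trans h2
    nlinarith
  have e : P.lam * t * V i - (1 - P.discount t) * V i =
      (P.discount t - 1 + P.lam * t) * V i := by ring
  rw [e, abs_mul]
  calc _ ≤ (P.lam * t) ^ 2 * |V i| := mul_le_mul_of_nonneg_right h1 (abs_nonneg _)
    _ = P.lam * t ^ 2 * (P.lam * |V i|) := by ring
    _ ≤ P.lam * t ^ 2 * (2 * Mg) := by gcongr
    _ = _ := by ring

/-- Comparison of the Hamiltonian at nearby points, with the momentum of a quadratic penalty. -/
theorem IsRegular.abs_ham_sub_le (hP : P.IsRegular Lf Lg Mf Mg) (ht : 0 < t)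
    {x y w : EuclideanSpace ℝ (Fin d)} {κ K : ℝ} (hκ : 0 < κ) (hw : ‖w‖ = ‖x - y‖)
    (hr : κ * ‖x - y‖ ≤ K) {a : EuclideanSpace ℝ (Fin m)} (ha : a ∈ P.A) :
    |P.ham y ((2 * κ) • w) a - (P.g x a + P.discount t * inner ℝ ((2 * κ) • w) (P.f x a))| ≤
      (Lg * K + 2 * Lf * K ^ 2) / κ + 2 * P.lam * K * Mf * t := by
  set p := (2 * κ) • w with hp
  have hlam := hP.lam_pos
  have hMf := hP.Mf_nonneg
  -- Momenta stay below `2 * K` uniformly in `κ`, while the two points are within `K / κ`.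
  have hpn : ‖p‖ = 2 * (κ * ‖x - y‖) := by
    rw [hp, norm_smul, hw, Real.norm_of_nonneg (by positivity)]; ring
  have hp2 : ‖p‖ ≤ 2 * K := by rw [hpn]; linarith
  have hr' : ‖x - y‖ ≤ K / κ := by rw [le_div_iff₀ hκ, mul_comm]; exact hr
  have hK : 0 ≤ K := le_trans (by positivity) hr
  have h1 : |P.g y a - P.g x a| ≤ Lg * (K / κ) :=
    (hP.abs_g_sub_le ha y x).trans (by rw [norm_sub_rev]; gcongr)
  have h2 : |inner ℝ p (P.f y a) - inner ℝ p (P.f x a)| ≤ 2 * K * (Lf * (K / κ)) :=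
    (hP.abs_inner_f_sub_le ha p y x).trans (by rw [norm_sub_rev]; gcongr)
  have h3 : |(P.discount t - 1) * inner ℝ p (P.f x a)| ≤ P.lam * t * (2 * K * Mf) := by
    rw [abs_mul]
    have e := abs_exp_neg_sub_one_le (mul_pos hlam ht).le
    rw [← neg_mul] at e
    refine mul_le_mul e ((abs_real_inner_le_norm _ _).trans ?_) (abs_nonneg _) (by positivity)
    exact mul_le_mul hp2 (hP.norm_f_le _ _ ha) (norm_nonneg _) (by positivity)
  have e : (Lg * K + 2 * Lf * K ^ 2) / κ + 2 * P.lam * K * Mf * t =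
      Lg * (K / κ) + 2 * K * (Lf * (K / κ)) + P.lam * t * (2 * K * Mf) := by
    field_simp
  rw [e, ham]
  rw [abs_le] at *
  constructor <;> linarith [h1.1, h1.2, h2.1, h2.2, h3.1, h3.2]

/-- One half of the a priori error estimate: the discrete solution from above. -/
theorem IsRegular.fixedPt_sub_value_le (hP : P.IsRegular Lf Lg Mf Mg) (ht : 0 < t)
    (htl : P.lam * t ≤ 1 / 2) (hdx : G.dx ≤ t) (hI : P.Invariant G t)
    (hV : Function.IsFixedPt (P.bellman G t) V) {K : ℝ≥0} (hK : LipschitzWith K P.value)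
    {κ : ℝ} (hκ : 0 < κ) (i : G.Node) :
    P.lam * (V i - P.value (G.point i)) ≤ 2 * P.lam * Mg * t + κ * t * (Mf ^ 2 + d) +
      ((Lg * K + 2 * Lf * K ^ 2) / κ + 2 * P.lam * K * Mf * t) := by
  have : Nonempty G.Node := ⟨i⟩
  have hlam := hP.lam_pos
  have hγ0 := P.discount_pos t
  have hγ1 := hP.discount_lt_one ht
  -- Comparing the maximum with `y = x₀` and using that the value function is Lipschitz gives `κ ‖x₀
  -- - y₀‖ ≤ K`; varying the node with `y₀` fixed gives the quadratic bound on `V`.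
  obtain ⟨i₀, y₀, hmax⟩ := exists_forall_penalized_le G.point V (φ := fun y => -P.value y)
    hK.continuous.neg (fun y => by rw [abs_neg]; exact hP.abs_value_le y) hκ
  set x₀ := G.point i₀ with hx₀
  have hr : κ * ‖x₀ - y₀‖ ≤ K := by
    have h1 := hmax i₀ x₀
    rw [← hx₀, sub_self, norm_zero] at h1
    have h2 := (le_abs_self _).trans ((Real.dist_eq _ _).symm.le.trans (hK.dist_le_mul x₀ y₀))
    rw [dist_eq_norm] at h2
    rcases (norm_nonneg (x₀ - y₀)).eq_or_lt with h3 | h3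
    · rw [← h3, mul_zero]; exact K.2
    · have : κ * ‖x₀ - y₀‖ * ‖x₀ - y₀‖ ≤ K * ‖x₀ - y₀‖ := by nlinarith
      exact le_of_mul_le_mul_right this h3
  have hi := hmax i (G.point i)
  rw [sub_self, norm_zero] at hi
  have hVq : ∀ j, V j ≤ (V i₀ - κ * ‖x₀ - y₀‖ ^ 2) + κ * ‖G.point j - y₀‖ ^ 2 := fun j => by
    have := hmax j y₀
    linarith
  set E := 2 * P.lam * Mg * t + κ * t * (Mf ^ 2 + d) +
      ((Lg * K + 2 * Lf * K ^ 2) / κ + 2 * P.lam * K * Mf * t) with hE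
  have hsuper : P.lam * V i₀ - E ≤ P.lam * P.value y₀ := by
    -- `y₀` minimizes `v + κ ‖· - x₀‖²`, so `v` is touched from below by a concave quadratic, with
    -- momentum `2κ (x₀ - y₀)`.
    refine hP.value_supersolution (x₀ := x₀) (κ := -κ) (fun y => ?_) fun a ha => ?_
    · have := hmax i₀ y
      rw [← hx₀, norm_sub_rev, norm_sub_rev x₀ y₀] at this
      linarith
    · have e : (2 * -κ) • (y₀ - x₀) = (2 * κ) • (x₀ - y₀) := by
        rw [← neg_sub x₀ y₀, smul_neg, mul_neg, neg_smul, neg_neg]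
      rw [e]
      have h1 := hP.bellman_le (t := t) V i₀ ha
      rw [hV.eq, stepCost, ← hx₀] at h1
      have h2 := interp_le_of_quadratic G (hI i₀ a ha) hκ.le hVq
      rw [← hx₀] at h2
      have h3 := mul_le_mul_of_nonneg_left (hP.norm_step_sub_sq_le x₀ y₀ ha t) hκ.le
      have h4 := (abs_le.1 (hP.abs_discount_error_le ht htl hI hV i₀)).2
      have h5 := (abs_le.1 (hP.abs_ham_sub_le ht hκ (w := x₀ - y₀) rfl hr ha)).1
      rw [inner_smul_left] at h5
      simp only [conj_trivial] at h5
      -- The mesh condition enters here: the interpolation error `κ d dx²` stays of order `t` after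
      -- division by `t`.
      have h6 : G.dx ^ 2 ≤ t ^ 2 := pow_le_pow_left₀ G.dx_pos.le hdx 2
      have h7 : κ * (d * G.dx ^ 2) ≤ κ * (d * t ^ 2) := by gcongr
      set q : ℝ := inner ℝ (x₀ - y₀) (P.f x₀ a)
      have h8 : P.discount t * G.interp V (x₀ + t • P.f x₀ a) ≤
          P.discount t * (V i₀ + κ * (2 * t * q)) + κ * (t ^ 2 * Mf ^ 2 + d * t ^ 2) := by
        have e1 : G.interp V (x₀ + t • P.f x₀ a) ≤
            V i₀ + κ * (2 * t * q) + κ * (t ^ 2 * Mf ^ 2 + d * t ^ 2) := by linarith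
        have e2 : 0 ≤ κ * (t ^ 2 * Mf ^ 2 + d * t ^ 2) := by positivity
        have := mul_le_mul_of_nonneg_left e1 hγ0.le
        nlinarith
      have h9 : t * (P.lam * V i₀ - 2 * P.lam * Mg * t - κ * t * (Mf ^ 2 + d)) ≤
          t * (P.g x₀ a + P.discount t * (2 * κ * q)) := by nlinarith
      have h10 := le_of_mul_le_mul_left h9 ht
      linarith
  have : P.lam * (V i - P.value (G.point i)) ≤ P.lam * (V i₀ - P.value y₀) := by
    refine mul_le_mul_of_nonneg_left ?_ hlam.le
    have : 0 ≤ κ * ‖x₀ - y₀‖ ^ 2 := by positivity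
    linarith
  linarith

/-- The other half of the a priori error estimate: the discrete solution from below. -/
theorem IsRegular.value_sub_fixedPt_le (hP : P.IsRegular Lf Lg Mf Mg) (ht : 0 < t)
    (htl : P.lam * t ≤ 1 / 2) (hdx : G.dx ≤ t) (hI : P.Invariant G t)
    (hV : Function.IsFixedPt (P.bellman G t) V) {K : ℝ≥0} (hK : LipschitzWith K P.value)
    {κ : ℝ} (hκ : 0 < κ) (i : G.Node) :
    P.lam * (P.value (G.point i) - V i) ≤ 2 * P.lam * Mg * t + κ * t * (Mf ^ 2 + d) +
      ((Lg * K + 2 * Lf * K ^ 2) / κ + 2 * P.lam * K * Mf * t) := by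
  have : Nonempty G.Node := ⟨i⟩
  have hlam := hP.lam_pos
  have hγ0 := P.discount_pos t
  have hγ1 := hP.discount_lt_one ht
  obtain ⟨i₀, y₀, hmax⟩ := exists_forall_penalized_le G.point (fun i => -V i)
    hK.continuous hP.abs_value_le hκ
  set x₀ := G.point i₀ with hx₀
  have hr : κ * ‖x₀ - y₀‖ ≤ K := by
    have h1 := hmax i₀ x₀
    rw [← hx₀, sub_self, norm_zero] at h1
    have h2 := (le_abs_self _).trans ((Real.dist_eq _ _).symm.le.trans (hK.dist_le_mul y₀ x₀))
    rw [dist_eq_norm, norm_sub_rev] at h2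
    rcases (norm_nonneg (x₀ - y₀)).eq_or_lt with h3 | h3
    · rw [← h3, mul_zero]; exact K.2
    · have : κ * ‖x₀ - y₀‖ * ‖x₀ - y₀‖ ≤ K * ‖x₀ - y₀‖ := by nlinarith
      exact le_of_mul_le_mul_right this h3
  have hi := hmax i (G.point i)
  rw [sub_self, norm_zero] at hi
  have hVq : ∀ j, -V j ≤ (-V i₀ - κ * ‖x₀ - y₀‖ ^ 2) + κ * ‖G.point j - y₀‖ ^ 2 := fun j => by
    have := hmax j y₀
    linarith
  set E := 2 * P.lam * Mg * t + κ * t * (Mf ^ 2 + d) +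
      ((Lg * K + 2 * Lf * K ^ 2) / κ + 2 * P.lam * K * Mf * t) with hE
  have hsub : P.lam * P.value y₀ ≤ P.lam * V i₀ + E := by
    -- The subsolution inequality holds for every control, so it may be used at the one attaining
    -- the discrete minimum at `i₀`.
    obtain ⟨a, ha, hmin⟩ := hP.exists_isMinOn (t := t) V i₀
    have h0 := hP.value_subsolution (x₀ := x₀) (y₀ := y₀) (κ := κ) (fun y => by
      have := hmax i₀ y
      rw [← hx₀, norm_sub_rev, norm_sub_rev x₀ y₀] at this
      linarith) ha
    have h1 := bellman_eq_stepCost ha hmin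
    rw [hV.eq, stepCost, ← hx₀] at h1
    have h2 := interp_le_of_quadratic G (hI i₀ a ha) hκ.le hVq
    rw [← hx₀, Grid.interp_neg] at h2
    have h3 := mul_le_mul_of_nonneg_left (hP.norm_step_sub_sq_le x₀ y₀ ha t) hκ.le
    have h4 := (abs_le.1 (hP.abs_discount_error_le ht htl hI hV i₀)).1
    have h5 := (abs_le.1 (hP.abs_ham_sub_le ht hκ (w := y₀ - x₀) (norm_sub_rev _ _) hr ha)).2
    rw [inner_smul_left, ← neg_sub x₀ y₀, inner_neg_left] at h5
    rw [← neg_sub x₀ y₀] at h0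
    simp only [conj_trivial] at h5
    have h6 : G.dx ^ 2 ≤ t ^ 2 := pow_le_pow_left₀ G.dx_pos.le hdx 2
    have h7 : κ * (d * G.dx ^ 2) ≤ κ * (d * t ^ 2) := by gcongr
    set q : ℝ := inner ℝ (x₀ - y₀) (P.f x₀ a)
    have h8 : P.discount t * (V i₀ - κ * (2 * t * q)) - κ * (t ^ 2 * Mf ^ 2 + d * t ^ 2) ≤
        P.discount t * G.interp V (x₀ + t • P.f x₀ a) := by
      have e1 : V i₀ - κ * (2 * t * q) - κ * (t ^ 2 * Mf ^ 2 + d * t ^ 2) ≤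
          G.interp V (x₀ + t • P.f x₀ a) := by linarith
      have e2 : 0 ≤ κ * (t ^ 2 * Mf ^ 2 + d * t ^ 2) := by positivity
      have := mul_le_mul_of_nonneg_left e1 hγ0.le
      nlinarith
    have h9 : t * (P.g x₀ a + P.discount t * (2 * κ * -q)) ≤
        t * (P.lam * V i₀ + 2 * P.lam * Mg * t + κ * t * (Mf ^ 2 + d)) := by nlinarith
    have h10 := le_of_mul_le_mul_left h9 ht
    linarith
  have : P.lam * (P.value (G.point i) - V i) ≤ P.lam * (P.value y₀ - V i₀) := by
    refine mul_le_mul_of_nonneg_left ?_ hlam.le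
    have : 0 ≤ κ * ‖x₀ - y₀‖ ^ 2 := by positivity
    linarith
  linarith

/-- A priori error estimate of the semi-Lagrangian scheme, before optimizing in `κ`. -/
theorem IsRegular.exists_abs_value_sub_fixedPt_le (hP : P.IsRegular Lf Lg Mf Mg) :
    ∃ C : ℝ, 0 ≤ C ∧ ∀ (G : Grid l u) (t : ℝ), 0 < t → P.lam * t ≤ 1 / 2 → G.dx ≤ t →
      P.Invariant G t → ∀ V : G.Node → ℝ, Function.IsFixedPt (P.bellman G t) V →
      ∀ κ : ℝ, 1 ≤ κ → ∀ i, |P.value (G.point i) - V i| ≤ C * (κ * t + 1 / κ) := by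
  obtain ⟨K, hK⟩ := hP.exists_lipschitzWith_value
  have hlam := hP.lam_pos
  have hMf := hP.Mf_nonneg
  have hMg := hP.Mg_nonneg
  refine ⟨(2 * P.lam * Mg + (Mf ^ 2 + d) + (Lg * K + 2 * Lf * K ^ 2) + 2 * P.lam * K * Mf) /
    P.lam, by positivity, fun G t ht htl hdx hI V hV κ hκ i => ?_⟩
  have hκ0 : 0 < κ := by linarith
  have h1 := hP.fixedPt_sub_value_le ht htl hdx hI hV hK hκ0 i
  have h2 := hP.value_sub_fixedPt_le ht htl hdx hI hV hK hκ0 i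
  have h3 : 2 * P.lam * Mg * t + κ * t * (Mf ^ 2 + d) +
      ((Lg * K + 2 * Lf * K ^ 2) / κ + 2 * P.lam * K * Mf * t) ≤
      (2 * P.lam * Mg + (Mf ^ 2 + d) + (Lg * K + 2 * Lf * K ^ 2) + 2 * P.lam * K * Mf) *
        (κ * t + 1 / κ) := by
    have hκt : t ≤ κ * t := by nlinarith
    have hk : 0 ≤ 1 / κ := by positivity
    have e1 : 2 * P.lam * Mg * t ≤ 2 * P.lam * Mg * (κ * t + 1 / κ) := by gcongr; linarith
    have e2 : κ * t * (Mf ^ 2 + d) ≤ (Mf ^ 2 + d) * (κ * t + 1 / κ) := by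
      rw [mul_comm]; gcongr; linarith
    have e3 : (Lg * K + 2 * Lf * K ^ 2) / κ ≤
        (Lg * K + 2 * Lf * K ^ 2 : ℝ) * (κ * t + 1 / κ) := by
      rw [div_eq_mul_one_div]
      gcongr
      have : 0 < κ * t := by positivity
      linarith
    have e4 : 2 * P.lam * K * Mf * t ≤ 2 * P.lam * K * Mf * (κ * t + 1 / κ) := by
      gcongr; linarith
    linarith
  rw [div_mul_eq_mul_div, le_div_iff₀ hlam]
  have h4 : |P.value (G.point i) - V i| * P.lam = |P.lam * (P.value (G.point i) - V i)| := by
    rw [abs_mul, abs_of_pos hlam, mul_comm]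
  rw [h4, abs_le]
  constructor <;> linarith

end ControlProblem

/-! ### Choice of thresholds and the final statement -/

namespace ControlProblem

variable {d m : ℕ} {l u : Fin d → ℝ} {P : ControlProblem d m} {Lf Lg : ℝ≥0} {Mf Mg : ℝ}

/-- Fix `κ` first so that `C / κ ≤ ρ / 8`, then `τ` so that the terms in `t` are small. Coarse and
fine solutions are compared through `v`: interpolated coarse nodal errors `ρ / 2`, interpolation
error of `v` at most `ρ / 8`, fine scheme error `ρ / 4`. -/
theorem IsRegular.exists_step_bound (hP : P.IsRegular Lf Lg Mf Mg) {ρ : ℝ} (hρ : 0 < ρ) :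
    ∃ τ : ℝ, 0 < τ ∧ ∀ (Gc Gf : Grid l u) (tc tf : ℝ),
      0 < tc → tc ≤ τ → Gc.dx ≤ tc → P.Invariant Gc tc →
      0 < tf → tf ≤ τ → Gf.dx ≤ tf → P.Invariant Gf tf →
      ∀ V : Gf.Node → ℝ, Function.IsFixedPt (P.bellman Gf tf) V →
      ∀ V0 : Gc.Node → ℝ, ∃ N₀ : ℕ, ∀ N ≥ N₀,
        (∀ i, |P.value (Gc.point i) - P.valueIter Gc tc V0 N i| < ρ) ∧
        ‖Gc.transfer Gf (P.valueIter Gc tc V0 N) - V‖ < ρ := by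
  obtain ⟨K, hK⟩ := hP.exists_lipschitzWith_value
  obtain ⟨C, hC0, hC⟩ := hP.exists_abs_value_sub_fixedPt_le (l := l) (u := u)
  have hlam := hP.lam_pos
  set κ : ℝ := 1 + 8 * C / ρ with hκ
  have hκ1 : 1 ≤ κ := by rw [hκ]; have : 0 ≤ 8 * C / ρ := by positivity
                         linarith
  have hCκ : C * (1 / κ) ≤ ρ / 8 := by
    rw [mul_one_div, div_le_iff₀ (by linarith), hκ]
    have : ρ / 8 * (1 + 8 * C / ρ) = ρ / 8 + C := by field_simp
    linarith
  set B : ℝ := K * (d + 1) with hB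
  have hB0 : 0 ≤ B := by positivity
  have hCκ0 : 0 ≤ C * κ := by positivity
  refine ⟨min (1 / (2 * P.lam)) (min (ρ / (8 * (C * κ + 1))) (ρ / (8 * (B + 1)))),
    by positivity, ?_⟩
  set τ := min (1 / (2 * P.lam)) (min (ρ / (8 * (C * κ + 1))) (ρ / (8 * (B + 1)))) with hτ
  have hτ1 : ∀ t, t ≤ τ → P.lam * t ≤ 1 / 2 := fun t ht => by
    have h := ht.trans (min_le_left _ _)
    rw [le_div_iff₀ (by positivity)] at h
    linarith
  have hτ2 : ∀ t, 0 < t → t ≤ τ → C * (κ * t + 1 / κ) ≤ ρ / 4 := fun t ht0 ht => by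
    have h := ht.trans ((min_le_right _ _).trans (min_le_left _ _))
    rw [le_div_iff₀ (by positivity)] at h
    nlinarith
  have hτ3 : ∀ t, 0 < t → t ≤ τ → B * t ≤ ρ / 8 := fun t ht0 ht => by
    have h := ht.trans ((min_le_right _ _).trans (min_le_right _ _))
    rw [le_div_iff₀ (by positivity)] at h
    nlinarith
  intro Gc Gf tc tf htc htcτ hdxc hIc htf htfτ hdxf hIf V hV V0
  obtain ⟨Vc, hVc⟩ := hP.exists_isFixedPt_bellman htc hIc
  have hlim : Filter.Tendsto (fun N : ℕ => P.discount tc ^ N * ‖V0 - Vc‖) Filter.atTop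
      (nhds 0) := by
    have := (tendsto_pow_atTop_nhds_zero_of_lt_one (P.discount_pos tc).le
      (hP.discount_lt_one htc)).mul_const ‖V0 - Vc‖
    rwa [zero_mul] at this
  obtain ⟨N₀, hN₀⟩ := Filter.eventually_atTop.1
    (hlim.eventually_lt_const (show (0 : ℝ) < ρ / 4 by positivity))
  refine ⟨N₀, fun N hN => ?_⟩
  have hiter : ∀ i, |P.value (Gc.point i) - P.valueIter Gc tc V0 N i| ≤ ρ / 2 := fun i => by
    have h1 := hC Gc tc htc (hτ1 tc htcτ) hdxc hIc Vc hVc κ hκ1 i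
    have h2 : |(P.valueIter Gc tc V0 N - Vc) i| ≤ ρ / 4 := (norm_le_pi_norm _ i).trans
      ((hP.norm_valueIter_sub_le hIc hVc V0 N).trans (hN₀ N hN).le)
    have h3 := hτ2 tc htc htcτ
    rw [Pi.sub_apply] at h2
    rw [abs_le] at *
    constructor <;> linarith [h1.1, h1.2, h2.1, h2.2]
  refine ⟨fun i => (hiter i).trans_lt (by linarith), ?_⟩
  refine (pi_norm_lt_iff hρ).2 fun j => ?_
  have hbox := Gf.point_mem_box j
  have h1 : |Gc.interp ((fun i => P.value (Gc.point i)) - P.valueIter Gc tc V0 N) (Gf.point j)| ≤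
      ρ / 2 := Gc.abs_interp_le hbox fun i => hiter i
  rw [Grid.interp_sub] at h1
  have h2 := Gc.abs_interp_sub_le hK hbox
  have h3 := hC Gf tf htf (hτ1 tf htfτ) hdxf hIf V hV κ hκ1 j
  have h4 := hτ2 tf htf htfτ
  have h5 : K * (d + 1) * Gc.dx ≤ ρ / 8 :=
    (mul_le_mul_of_nonneg_left hdxc hB0).trans (hτ3 tc htc htcτ)
  rw [Real.norm_eq_abs, Pi.sub_apply, Grid.transfer, abs_lt]
  rw [abs_le] at h1 h2 h3
  constructor <;> linarith [h1.1, h1.2, h2.1, h2.2, h3.1, h3.2]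

end ControlProblem

theorem theorem4p4 {d m : ℕ} (P : ControlProblem d m) (l u : Fin d → ℝ)
    (hlu : ∀ k, l k < u k)
    (hA : IsCompact P.A) (hA0 : P.A.Nonempty)
    (hf : ContinuousOn (fun p : EuclideanSpace ℝ (Fin d) × EuclideanSpace ℝ (Fin m) =>
      P.f p.1 p.2) (Set.univ ×ˢ P.A))
    (hg : ContinuousOn (fun p : EuclideanSpace ℝ (Fin d) × EuclideanSpace ℝ (Fin m) =>
      P.g p.1 p.2) (Set.univ ×ˢ P.A))
    (Lf Lg : ℝ≥0) (Mf Mg : ℝ)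
    (hLf : ∀ a ∈ P.A, LipschitzWith Lf fun x => P.f x a)
    (hLg : ∀ a ∈ P.A, LipschitzWith Lg fun x => P.g x a)
    (hMf : ∀ x, ∀ a ∈ P.A, ‖P.f x a‖ ≤ Mf)
    (hMg : ∀ x, ∀ a ∈ P.A, |P.g x a| ≤ Mg)
    (hlam : (Lf : ℝ) < P.lam) :
    -- value iteration, and its transfer to a second grid, enter any ball around the value
    -- function and around the discrete solution, if the discretizations are fine enough
    (∀ ρ : ℝ, 0 < ρ → ∃ τ : ℝ, 0 < τ ∧ ∃ η : ℝ, 0 < η ∧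
      ∀ (Gc Gf : Grid l u) (tc tf : ℝ),
        0 < tc → tc ≤ τ → Gc.dx ≤ η * tc → P.Invariant Gc tc →
        0 < tf → tf ≤ τ → Gf.dx ≤ η * tf → P.Invariant Gf tf →
        ∀ V : Gf.Node → ℝ, Function.IsFixedPt (P.bellman Gf tf) V →
        ∀ V0 : Gc.Node → ℝ, ∃ N₀ : ℕ, ∀ N ≥ N₀,
          (∀ i, |P.value (Gc.point i) - P.valueIter Gc tc V0 N i| < ρ) ∧
          ‖Gc.transfer Gf (P.valueIter Gc tc V0 N) - V‖ < ρ) ∧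
    -- on any fixed discretization, value iteration contracts to the discrete solution
    (∀ (G : Grid l u) (t : ℝ), 0 < t → P.Invariant G t →
      ∀ V : G.Node → ℝ, Function.IsFixedPt (P.bellman G t) V →
      ∀ (V0 : G.Node → ℝ) (N : ℕ),
        ‖P.valueIter G t V0 N - V‖ ≤ P.discount t ^ N * ‖V0 - V‖) ∧
    -- policy iteration on the fine grid, started from the transferred value iterate
    (∀ (C : ℝ) (Gc Gf : Grid l u) (tc tf : ℝ), 0 < tc → 0 < tf → P.Invariant Gf tf →
      ∀ V : Gf.Node → ℝ, Function.IsFixedPt (P.bellman Gf tf) V →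
      ∀ (V0 : Gc.Node → ℝ) (N : ℕ) (W0 : Gf.Node → ℝ),
        W0 = Gc.transfer Gf (P.valueIter Gc tc V0 N) →
      ∀ (D : Set (Gf.Node → ℝ)) (α ω : ℝ),
        NewtonAssumptions (fun U => U - P.bellman Gf tf U) D W0 α ω →
        (1 + P.discount tf) * ω * Gf.dx ^ 2 ≤ 2 * P.discount tf * C →
      ∀ μ : ℝ, μ = C * (P.discount tf / (Gf.dx ^ 2 * (1 - P.discount tf))) →
        (∃ W, P.IsPolicyIteration Gf tf W ∧ W 0 = W0) ∧
        ∀ W, P.IsPolicyIteration Gf tf W → W 0 = W0 →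
          Filter.Tendsto W Filter.atTop (nhds V) ∧
          (∀ n, ‖W (n + 1) - V‖ ≤ μ * ‖W n - V‖ ^ 2) ∧
          ∀ ρ : ℝ, ‖W0 - V‖ ≤ ρ → ρ < 1 → μ * ρ < 1 →
            ∀ M : ℕ, 1 ≤ M →
              ‖W M - V‖ ≤ μ * ∏ k ∈ Finset.Icc 1 M, (μ ^ (2 * (k - 1)) * ρ ^ 2)) := by
  have hP : P.IsRegular Lf Lg Mf Mg := ⟨hA, hA0, hf, hg, hLf, hLg, hMf, hMg, hlam⟩
  refine ⟨fun ρ hρ => ?_, fun G t _ hI V hV V0 N => hP.norm_valueIter_sub_le hI hV V0 N, ?_⟩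
  · obtain ⟨τ, hτ, H⟩ := hP.exists_step_bound (l := l) (u := u) hρ
    -- The error estimate needs only `Δx ≤ Δt`, so `η = 1` works for every `ρ`.
    refine ⟨τ, hτ, 1, one_pos, fun Gc Gf tc tf htc htcτ hdxc hIc htf htfτ hdxf hIf => ?_⟩
    rw [one_mul] at hdxc hdxf
    exact H Gc Gf tc tf htc htcτ hdxc hIc htf htfτ hdxf hIf
  · intro C Gc Gf tc tf _ htf hI V hV V0 N W0 _ D α ω hN hC μ hμ
    refine ⟨hP.exists_isPolicyIteration htf hI W0, ?_⟩
    rintro W hW rfl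
    have hγ0 := P.discount_pos tf
    have hγ1 : 0 < 1 - P.discount tf := sub_pos.2 (hP.discount_lt_one htf)
    have hdx := Gf.dx_pos
    have hω := hN.omega_pos
    -- After cancelling `1 - γ` and clearing `dx²`, this is the condition imposed on `C`. It also
    -- makes `μ` nonnegative, since `ω > 0`.
    have hcoef : (1 + P.discount tf) / (1 - P.discount tf) * (ω / 2) ≤ μ := by
      rw [hμ, mul_div_assoc' C, div_mul_div_comm, div_le_div_iff₀ (by positivity) (by positivity)]
      have := mul_le_mul_of_nonneg_right hC hγ1.le
      linarith
    have hμ0 : 0 ≤ μ := le_trans (by positivity) hcoef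
    have hquad : ∀ n, ‖W (n + 1) - V‖ ≤ μ * ‖W n - V‖ ^ 2 := fun n =>
      (hP.policyIteration_quadratic htf hI hV hN hW n).trans
        (mul_le_mul_of_nonneg_right hcoef (sq_nonneg _))
    refine ⟨?_, hquad, fun ρ h0 hρ1 hμρ M hM => ?_⟩
    · obtain ⟨a, ha⟩ := hW
      exact hP.tendsto_policyIteration htf hI hV ha
    · exact (le_pow_of_quadratic hμ0 (fun n => norm_nonneg (W n - V)) h0 hquad M).trans
        (pow_bound_le_prod hμ0 ((norm_nonneg _).trans h0) hρ1 hμρ hM)
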